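/- Let $M \subseteq B(H)$ be a finite von Neumann algebra on a complex Hilbert space $H$, with center $Z(M)$. Let $N \subseteq Z(M)$ be a von Neumann subalgebra, $E : M \to N$ a normal, faithful, tracial conditional expectation, and $\mathcal U$ a character on $N$, that is, a unital multiplicative linear functional $N \to \mathbb C$. The set $$I_{E,\mathcal U} = \{x \in M : \mathcal U(E(x^*x)) = 0\}$$ is a $*$-closed two-sided ideal. The ultrafiber is the quotient $M^{/E,\mathcal U} = M / I_{E,\mathcal U}$, with the induced $*$-algebra structure and the trace $\tau_{E,\mathcal U}(x + I_{E,\mathcal U}) = \mathcal U(E(x))$. Let $\pi_{E,\mathcal U} : M \to M^{/E,\mathcal U}$ be the quotient map. The restriction $E|_{Z(M)} : Z(M) \to N$ is again a normal, faithful, tracial conditional expectation, so the ultrafiber $Z(M)^{/E|_{Z(M)},\mathcal U}$ is defined in the same way. Then $$Z\bigl(M^{/E,\mathcal U}\bigr) = \pi_{E,\mathcal U}(Z(M)) \cong Z(M)^{/E|_{Z(M)},\mathcal U},$$ where the isomorphism is the trace-preserving $*$-isomorphism from $Z(M)^{/E|_{Z(M)},\mathcal U}$ onto $Z(M^{/E,\mathcal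 U})$ that sends the class of $z \in Z(M)$ to $\pi_{E,\mathcal U}(z)$. In particular, if $N = Z(M)$ (so that $E$ is the center-valued trace of $M$), then $M^{/E,\mathcal U}$ is a factor: it is a nonzero $*$-algebra that is $*$-isomorphic to a von Neumann algebra, and its center is $\mathbb C 1$. -/

import Mathlib

open scoped ComplexOrder

universe u

namespace VonNeumannAlgebra

section Basic

variable {H : Type u} [NormedAddCommGroup H] [InnerProductSpace ℂ H] [CompleteSpace H]

instance instSMulMemClass : SMulMemClass (VonNeumannAlgebra H) ℂ (H →L[ℂ] H) where
  smul_mem {s} c _ hx := s.toStarSubalgebra.smul_mem hx c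

theorem isClosed (M : VonNeumannAlgebra H) : IsClosed (M : Set (H →L[ℂ] H)) := by
  rw [← M.centralizer_centralizer]
  exact Set.isClosed_centralizer _

/-- A von Neumann algebra with the operator norm is a C⋆-algebra. -/
noncomputable instance instCStarAlgebra (M : VonNeumannAlgebra H) : CStarAlgebra M :=
  haveI : IsClosed (M : Set (H →L[ℂ] H)) := M.isClosed
  StarSubalgebra.cstarAlgebra M

/-- The order on `M` is the Loewner order of operators on `H`; it makes `M` a star-ordered ring. -/
instance instStarOrderedRing (M : VonNeumannAlgebra H) : StarOrderedRing M :=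
  StarOrderedRing.of_nonneg_iff'
    (fun {x y} hxy z => by
      change (z : H →L[ℂ] H) + x ≤ z + y
      gcongr)
    (fun x => by
      constructor
      · intro hx
        have hx' : (0 : H →L[ℂ] H) ≤ (x : H →L[ℂ] H) := hx
        have hmem : CFC.sqrt (x : H →L[ℂ] H) ∈ M := by
          have : IsClosed (M : Set (H →L[ℂ] H)) := M.isClosed
          rw [CFC.sqrt_eq_cfc, cfc_nnreal_eq_real _ (x : H →L[ℂ] H)]
          exact cfc_mem (𝕜 := ℝ) (𝕜' := ℂ) _ x.2
        refine ⟨⟨CFC.sqrt (x : H →L[ℂ] H), hmem⟩, Subtype.ext ?_⟩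
        have hs : star (CFC.sqrt (x : H →L[ℂ] H)) = CFC.sqrt (x : H →L[ℂ] H) :=
          (IsSelfAdjoint.of_nonneg (CFC.sqrt_nonneg _)).star_eq
        change (x : H →L[ℂ] H) = star (CFC.sqrt (x : H →L[ℂ] H)) * CFC.sqrt (x : H →L[ℂ] H)
        rw [hs, CFC.sqrt_mul_sqrt_self _ hx']
      · rintro ⟨s, rfl⟩
        change (0 : H →L[ℂ] H) ≤ star (s : H →L[ℂ] H) * (s : H →L[ℂ] H)
        exact star_mul_self_nonneg _)

/-- A von Neumann algebra is finite if every isometry in it is a unitary. -/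
def IsFinite (M : VonNeumannAlgebra H) : Prop :=
  ∀ v : M, star v * v = 1 → v * star v = 1

/-- The center `Z(M) = M ∩ M'` of a von Neumann algebra, as a von Neumann algebra. -/
noncomputable def center (M : VonNeumannAlgebra H) : VonNeumannAlgebra H where
  toStarSubalgebra := M.toStarSubalgebra ⊓ M.commutant.toStarSubalgebra
  centralizer_centralizer' := by
    have h : (M.toStarSubalgebra ⊓ M.commutant.toStarSubalgebra).carrier =
        Set.centralizer ((M.commutant : Set (H →L[ℂ] H)) ∪ (M : Set (H →L[ℂ] H))) := by
      rw [Set.centralizer_union, ← coe_commutant, ← coe_commutant, commutant_commutant]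
      rfl
    rw [h, Set.centralizer_centralizer_centralizer]

theorem mem_center_iff {M : VonNeumannAlgebra H} {x : H →L[ℂ] H} :
    x ∈ M.center ↔ x ∈ M ∧ ∀ y ∈ M, y * x = x * y := by
  rw [← mem_commutant_iff]
  exact Iff.rfl

theorem center_le (M : VonNeumannAlgebra H) : M.center ≤ M :=
  fun _ hx => (mem_center_iff.1 hx).1

/-- `M.center` is the center of the ring `M`. -/
theorem coe_mem_center_iff {M : VonNeumannAlgebra H} {x : M} :
    (x : H →L[ℂ] H) ∈ M.center ↔ x ∈ Set.center M := by
  rw [mem_center_iff, Semigroup.mem_center_iff]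
  exact ⟨fun h y => Subtype.ext (h.2 y y.2),
    fun h => ⟨x.2, fun y hy => congrArg Subtype.val (h ⟨y, hy⟩)⟩⟩

/-- The inclusion `N ⊆ M` of von Neumann algebras on the same Hilbert space. -/
def inclusion {N M : VonNeumannAlgebra H} (h : N ≤ M) : N →⋆ₐ[ℂ] M where
  toFun x := ⟨x, h x.2⟩
  map_one' := rfl
  map_mul' _ _ := rfl
  map_zero' := rfl
  map_add' _ _ := rfl
  commutes' _ := rfl
  map_star' _ := rfl

end Basic

/-- A normal, faithful, tracial conditional expectation from the von Neumann algebra `M` onto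
its von Neumann subalgebra `N`. -/
structure TracialCondExp {H : Type u} [NormedAddCommGroup H] [InnerProductSpace ℂ H]
    [CompleteSpace H] (M N : VonNeumannAlgebra H) where
  le : N ≤ M
  toLinearMap : M →ₗ[ℂ] N
  nonneg : ∀ x : M, 0 ≤ x → 0 ≤ toLinearMap x
  apply_of_mem : ∀ a : N, toLinearMap (inclusion le a) = a
  bimodule : ∀ (a b : N) (x : M),
    toLinearMap (inclusion le a * x * inclusion le b) = a * toLinearMap x * b
  tracial : ∀ x y : M, toLinearMap (x * y) = toLinearMap (y * x)
  faithful : ∀ x : M, toLinearMap (star x * x) = 0 → x = 0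
  /-- Normality: the map preserves suprema of bounded increasing families, that is, of nonempty
  upward directed sets. Suprema are those of operators on `H`, which for such a family lie in the
  von Neumann algebra and are the suprema formed there. -/
  normal : ∀ (D : Set M) (s : M), D.Nonempty → DirectedOn (· ≤ ·) D →
    IsLUB ((fun x : M => (x : H →L[ℂ] H)) '' D) (s : H →L[ℂ] H) →
    IsLUB ((fun x : M => (toLinearMap x : H →L[ℂ] H)) '' D) (toLinearMap s : H →L[ℂ] H)

namespace TracialCondExp

variable {H : Type u} [NormedAddCommGroup H] [InnerProductSpace ℂ H] [CompleteSpace H]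
  {M N : VonNeumannAlgebra H}

/-- The restriction `E|_{Z(M)} : Z(M) → N`, for `N ⊆ Z(M)`. -/
noncomputable def restrictCenter (E : TracialCondExp M N) (hN : N ≤ M.center) : TracialCondExp M.center N where
  le := hN
  toLinearMap := E.toLinearMap ∘ₗ (inclusion M.center_le).toAlgHom.toLinearMap
  nonneg x hx := E.nonneg (inclusion M.center_le x) hx
  apply_of_mem a := E.apply_of_mem a
  bimodule a b x := E.bimodule a b (inclusion M.center_le x)
  tracial x y := E.tracial (inclusion M.center_le x) (inclusion M.center_le y)
  faithful x hx := by
    have h := E.faithful (inclusion M.center_le x) hx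
    exact Subtype.ext (congrArg (Subtype.val : M → H →L[ℂ] H) h)
  normal D s hD hdir hs := by
    have := E.normal (inclusion M.center_le '' D) (inclusion M.center_le s) (hD.image _)
      (by
        rintro _ ⟨x, hx, rfl⟩ _ ⟨y, hy, rfl⟩
        obtain ⟨z, hz, hxz, hyz⟩ := hdir x hx y hy
        exact ⟨_, ⟨z, hz, rfl⟩, hxz, hyz⟩)
      (by rw [Set.image_image]; exact hs)
    rw [Set.image_image] at this
    exact this

/-- The positive functional `x ↦ 𝒰 (E x)` on `M`. A character on `N` is a unital algebra
homomorphism `N → ℂ`. -/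
noncomputable def functional (E : TracialCondExp M N) (U : N →ₐ[ℂ] ℂ) : M →ₚ[ℂ] ℂ :=
  PositiveLinearMap.mk₀ (U.toLinearMap ∘ₗ E.toLinearMap) (fun x hx => by
    obtain ⟨s, hs⟩ := (CStarAlgebra.nonneg_iff_eq_star_mul_self).1 (E.nonneg x hx)
    change 0 ≤ U (E.toLinearMap x)
    rw [hs, map_mul, map_star]
    exact star_mul_self_nonneg _)

theorem functional_apply (E : TracialCondExp M N) (U : N →ₐ[ℂ] ℂ) (x : M) :
    E.functional U x = U (E.toLinearMap x) := rfl

theorem functional_comm (E : TracialCondExp M N) (U : N →ₐ[ℂ] ℂ) (x y : M) :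
    E.functional U (x * y) = E.functional U (y * x) := by
  rw [functional_apply, functional_apply, E.tracial]

theorem functional_star_mul_self_eq_zero_iff (E : TracialCondExp M N) (U : N →ₐ[ℂ] ℂ) (x : M) :
    E.functional U (star x * x) = 0 ↔ ‖(E.functional U).toPreGNS x‖ = 0 := by
  have h := (E.functional U).preGNS_norm_sq ((E.functional U).toPreGNS x)
  rw [PositiveLinearMap.ofPreGNS_toPreGNS] at h
  rw [← h, ← Complex.ofReal_pow, Complex.ofReal_eq_zero, sq_eq_zero_iff]

/-- The ideal `{x ∈ M : 𝒰 (E (x⋆ x)) = 0}`. -/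
noncomputable def ultrafiberIdeal (E : TracialCondExp M N) (U : N →ₐ[ℂ] ℂ) : Ideal M where
  carrier := {x | U (E.toLinearMap (star x * x)) = 0}
  zero_mem' := by simp
  add_mem' {x y} hx hy := by
    have hx' := (E.functional_star_mul_self_eq_zero_iff U x).1 hx
    have hy' := (E.functional_star_mul_self_eq_zero_iff U y).1 hy
    refine (E.functional_star_mul_self_eq_zero_iff U (x + y)).2 ?_
    rw [map_add]
    refine le_antisymm ((norm_add_le _ _).trans ?_) (norm_nonneg _)
    rw [hx', hy', add_zero]
  smul_mem' a x hx := by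
    have hx' := (E.functional_star_mul_self_eq_zero_iff U x).1 hx
    refine (E.functional_star_mul_self_eq_zero_iff U (a • x)).2 ?_
    have h := ((E.functional U).leftMulMapPreGNS a).le_opNorm ((E.functional U).toPreGNS x)
    rw [hx', mul_zero] at h
    exact le_antisymm h (norm_nonneg _)

theorem mem_ultrafiberIdeal {E : TracialCondExp M N} {U : N →ₐ[ℂ] ℂ} {x : M} :
    x ∈ E.ultrafiberIdeal U ↔ U (E.toLinearMap (star x * x)) = 0 := Iff.rfl

theorem star_mem_ultrafiberIdeal {E : TracialCondExp M N} {U : N →ₐ[ℂ] ℂ} {x : M}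
    (hx : x ∈ E.ultrafiberIdeal U) : star x ∈ E.ultrafiberIdeal U := by
  rw [mem_ultrafiberIdeal] at hx ⊢
  rw [star_star, E.tracial, hx]

instance instIsTwoSided (E : TracialCondExp M N) (U : N →ₐ[ℂ] ℂ) :
    (E.ultrafiberIdeal U).IsTwoSided where
  mul_mem_of_left {x} b hx := by
    have h := (E.ultrafiberIdeal U).mul_mem_left (star b) (star_mem_ultrafiberIdeal hx)
    simpa using star_mem_ultrafiberIdeal h

theorem functional_eq_zero_of_mem {E : TracialCondExp M N} {U : N →ₐ[ℂ] ℂ} {x : M}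
    (hx : x ∈ E.ultrafiberIdeal U) : E.functional U x = 0 := by
  have hx' := (E.functional_star_mul_self_eq_zero_iff U x).1 hx
  have h := norm_inner_le_norm (𝕜 := ℂ) ((E.functional U).toPreGNS 1) ((E.functional U).toPreGNS x)
  rw [hx', mul_zero, PositiveLinearMap.preGNS_inner_def] at h
  simpa using h

/-- The ultrafiber `M^{/E,𝒰}`, the quotient of `M` by `{x ∈ M : 𝒰 (E (x⋆ x)) = 0}`. -/
def Ultrafiber (E : TracialCondExp M N) (U : N →ₐ[ℂ] ℂ) : Type u := M ⧸ E.ultrafiberIdeal U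

namespace Ultrafiber

variable (E : TracialCondExp M N) (U : N →ₐ[ℂ] ℂ)

noncomputable instance : Ring (E.Ultrafiber U) :=
  inferInstanceAs (Ring (M ⧸ E.ultrafiberIdeal U))

noncomputable instance : Algebra ℂ (E.Ultrafiber U) :=
  inferInstanceAs (Algebra ℂ (M ⧸ E.ultrafiberIdeal U))

/-- The canonical projection `π : M → M^{/E,𝒰}`, as an algebra homomorphism. -/
noncomputable def mk : M →ₐ[ℂ] E.Ultrafiber U :=
  Ideal.Quotient.mkₐ ℂ (E.ultrafiberIdeal U)

theorem mk_surjective : Function.Surjective (mk E U) :=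
  Ideal.Quotient.mk_surjective

theorem mk_eq_mk_iff {x y : M} : mk E U x = mk E U y ↔ x - y ∈ E.ultrafiberIdeal U :=
  Ideal.Quotient.eq

noncomputable instance : Star (E.Ultrafiber U) where
  star := Quotient.lift (fun x : M => mk E U (star x)) (fun x y hxy => by
    have h : x - y ∈ E.ultrafiberIdeal U := (Submodule.quotientRel_def _).1 hxy
    rw [mk_eq_mk_iff, ← star_sub]
    exact star_mem_ultrafiberIdeal h)

theorem star_mk (x : M) : star (mk E U x) = mk E U (star x) := rfl

noncomputable instance : StarRing (E.Ultrafiber U) where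
  star_involutive a := by
    obtain ⟨x, rfl⟩ := mk_surjective E U a
    simp only [star_mk, star_star]
  star_mul a b := by
    obtain ⟨x, rfl⟩ := mk_surjective E U a
    obtain ⟨y, rfl⟩ := mk_surjective E U b
    simp only [star_mk, ← map_mul, star_mul]
  star_add a b := by
    obtain ⟨x, rfl⟩ := mk_surjective E U a
    obtain ⟨y, rfl⟩ := mk_surjective E U b
    simp only [star_mk, ← map_add, star_add]

instance : StarModule ℂ (E.Ultrafiber U) where
  star_smul c a := by
    obtain ⟨x, rfl⟩ := mk_surjective E U a
    simp only [star_mk, ← map_smul, star_smul]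

/-- The canonical trace on the ultrafiber, sending the class of `x` to `𝒰 (E x)`. -/
noncomputable def trace : E.Ultrafiber U →ₗ[ℂ] ℂ where
  toFun := Quotient.lift (fun x : M => U (E.toLinearMap x)) (fun x y hxy => by
    have h : x - y ∈ E.ultrafiberIdeal U := (Submodule.quotientRel_def _).1 hxy
    have h0 := functional_eq_zero_of_mem h
    rw [map_sub, sub_eq_zero] at h0
    exact h0)
  map_add' a b := by
    obtain ⟨x, rfl⟩ := mk_surjective E U a
    obtain ⟨y, rfl⟩ := mk_surjective E U b
    exact (E.functional U).toLinearMap.map_add x y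
  map_smul' c a := by
    obtain ⟨x, rfl⟩ := mk_surjective E U a
    exact (E.functional U).toLinearMap.map_smul c x

theorem trace_mk (x : M) : trace E U (mk E U x) = U (E.toLinearMap x) := rfl

end Ultrafiber

end TracialCondExp

/-- A complex ⋆-algebra is a factor if it is nonzero, it is ⋆-isomorphic to a von Neumann algebra
on some Hilbert space, and its center consists of the scalars. -/
def IsFactor (A : Type u) [Ring A] [StarRing A] [Algebra ℂ A] : Prop :=
  Nontrivial A ∧
  (∃ (K : Type u) (_ : NormedAddCommGroup K) (_ : InnerProductSpace ℂ K) (_ : CompleteSpace K)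
    (R : VonNeumannAlgebra K), Nonempty (A ≃⋆ₐ[ℂ] R)) ∧
  Set.center A = Set.range (algebraMap ℂ A)

end VonNeumannAlgebra

/-! The center. The functional `𝒰 ∘ E` is positive, hence continuous, so its ideal is norm closed,
and the first claim holds for every closed, two-sided, ⋆-closed ideal `I` of `M`: an element that
commutes with `M` modulo `I` agrees modulo `I` with a central one
(`exists_central_of_mem_centralMod`). It suffices to halve norms. For self-adjoint `x` central
modulo `I`, comparing the kernel projection of `x⁻` with its complement yields a central projection
`c` such that `x⁺(1 - c)` and `x⁻c` lie in `I` (`exists_central_projection_mod`). Modulo `I`, `x` is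
then `x⁺c - x⁻(1 - c)`, which is within `‖x‖/2` of the central element `(‖x‖/2)(2c - 1)`. Iterating
sums a geometric series in the center. The ideal of the restricted expectation is the trace on
`Z(M)` of the ideal of `E`, so the ultrafiber of the center embeds with range the center. If `N =
Z(M)`, a central `z` differs from the scalar `𝒰 z` by an element of the ideal.

The von Neumann algebra. The ultrafiber acts faithfully on the GNS space of `𝒰 ∘ E`, and the image
of `M` is already its own bicommutant (`repHom_surjective`). A self-adjoint `S` in the bicommutant
is approximated in 2-norm by self-adjoint `b n` in `M`. Multiplying increments by elements of `N`
with `𝒰`-value 1 leaves classes unchanged but turns estimates at `𝒰` into uniform estimates `E(d⋆d)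
≤ ε` (`exists_cutoff`). The `b n` may be unbounded, but their resolvents at `-i` are contractions,
and a bounded sequence with summably small uniform 2-norm increments converges to an element of `M`
(`exists_tendsto_of_summable`, through the normality of `E`). So the image contains `(S + i)⁻¹`, and
every positive `T` satisfies `1 + T = t Y Y⋆` for such a resolvent `Y` and a real `t`. -/

/-! ### Weak operator limits and compactness of balls -/

section WeakLimit

open Filter Topology
open scoped InnerProductSpace

variable {H : Type u} [NormedAddCommGroup H] [InnerProductSpace ℂ H] {ι : Type*}

theorem ContinuousLinearMap.nonneg_iff_inner_nonneg {T : H →L[ℂ] H} :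
    0 ≤ T ↔ ∀ ξ, 0 ≤ ⟪ξ, T ξ⟫_ℂ := by
  rw [ContinuousLinearMap.nonneg_iff_isPositive]
  refine ⟨fun h => h.inner_nonneg_right, fun h => ?_⟩
  rw [ContinuousLinearMap.isPositive_iff_complex]
  intro ξ
  have h1 : 0 ≤ ⟪T ξ, ξ⟫_ℂ := by
    rw [← inner_conj_symm]
    exact star_nonneg_iff.2 (h ξ)
  exact ⟨RCLike.conj_eq_iff_re.1 (IsSelfAdjoint.of_nonneg h1), (RCLike.nonneg_iff.1 h1).1⟩

/-- Convergence of a family of operators in the weak operator topology along a filter. -/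
def IsWeakLimit (l : Filter ι) (x : ι → H →L[ℂ] H) (T : H →L[ℂ] H) : Prop :=
  ∀ ξ η : H, Tendsto (fun i => ⟪ξ, x i η⟫_ℂ) l (𝓝 ⟪ξ, T η⟫_ℂ)

namespace IsWeakLimit

variable {l : Filter ι} {x y : ι → H →L[ℂ] H} {S T : H →L[ℂ] H}

theorem unique [l.NeBot] (hS : IsWeakLimit l x S) (hT : IsWeakLimit l x T) : S = T :=
  ContinuousLinearMap.ext fun η => ext_inner_left ℂ fun ξ =>
    tendsto_nhds_unique (hS ξ η) (hT ξ η)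

theorem const (T : H →L[ℂ] H) : IsWeakLimit l (fun _ => T) T := fun _ _ => tendsto_const_nhds

theorem congr' (hT : IsWeakLimit l x T) (h : x =ᶠ[l] y) : IsWeakLimit l y T := fun ξ η =>
  (hT ξ η).congr' (h.mono fun i hi => by simp only [hi])

theorem sub (hS : IsWeakLimit l x S) (hT : IsWeakLimit l y T) :
    IsWeakLimit l (fun i => x i - y i) (S - T) := fun ξ η => by
  simpa only [sub_apply, inner_sub_right] using (hS ξ η).sub (hT ξ η)

theorem mul_right (hT : IsWeakLimit l x T) (A : H →L[ℂ] H) :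
    IsWeakLimit l (fun i => x i * A) (T * A) := fun ξ η => hT ξ (A η)

theorem norm_le [l.NeBot] (hT : IsWeakLimit l x T) {C : ℝ} (hC : 0 ≤ C)
    (h : ∀ᶠ i in l, ‖x i‖ ≤ C) : ‖T‖ ≤ C := by
  refine T.opNorm_le_bound hC fun η => ?_
  have h1 : ‖⟪T η, T η⟫_ℂ‖ ≤ ‖T η‖ * (C * ‖η‖) := by
    refine le_of_tendsto (hT (T η) η).norm (h.mono fun i hi => ?_)
    refine (norm_inner_le_norm _ _).trans ?_
    gcongr
    exact (x i).le_of_opNorm_le hi η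
  rw [inner_self_eq_norm_sq_to_K, norm_pow, RCLike.norm_ofReal, abs_norm, sq] at h1
  rcases (norm_nonneg (T η)).eq_or_lt with h0 | h0
  · rw [← h0]; positivity
  · exact le_of_mul_le_mul_left h1 h0

theorem nonneg [l.NeBot] (hT : IsWeakLimit l x T) (h : ∀ᶠ i in l, 0 ≤ x i) : 0 ≤ T := by
  rw [ContinuousLinearMap.nonneg_iff_inner_nonneg]
  exact fun ξ => ge_of_tendsto (hT ξ ξ)
    (h.mono fun i hi => ContinuousLinearMap.nonneg_iff_inner_nonneg.1 hi ξ)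

theorem le [CompleteSpace H] [l.NeBot] (hS : IsWeakLimit l x S)
    (hT : IsWeakLimit l y T) (h : ∀ᶠ i in l, x i ≤ y i) : S ≤ T :=
  sub_nonneg.1 ((hT.sub hS).nonneg (h.mono fun _ hi => sub_nonneg.2 hi))

variable [CompleteSpace H]

theorem mul_left (hT : IsWeakLimit l x T) (A : H →L[ℂ] H) :
    IsWeakLimit l (fun i => A * x i) (A * T) := fun ξ η => by
  simpa only [mul_apply_eq_comp, ContinuousLinearMap.adjoint_inner_left] using
    hT (ContinuousLinearMap.adjoint A ξ) η

theorem star (hT : IsWeakLimit l x T) : IsWeakLimit l (fun i => star (x i)) (star T) :=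
  fun ξ η => by
  have h := (hT η ξ).star
  simpa only [ContinuousLinearMap.star_eq_adjoint, ContinuousLinearMap.adjoint_inner_right,
    RCLike.star_def, inner_conj_symm] using h

theorem mem [l.NeBot] (hT : IsWeakLimit l x T) (M : VonNeumannAlgebra H)
    (h : ∀ᶠ i in l, x i ∈ M) : T ∈ M := by
  rw [← M.commutant_commutant, VonNeumannAlgebra.mem_commutant_iff]
  intro g hg
  rw [VonNeumannAlgebra.mem_commutant_iff] at hg
  exact (hT.mul_left g).unique ((hT.mul_right g).congr' (h.mono fun i hi => hg _ hi))

end IsWeakLimit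

/-- Each matrix coefficient stays in a compact disc, so it converges along the ultrafilter. The
limits form a bounded sesquilinear form, which the Riesz theorem represents by an operator. -/
theorem exists_isWeakLimit [CompleteSpace H] (l : Ultrafilter ι) (x : ι → H →L[ℂ] H) (C : ℝ)
    (h : ∀ i, ‖x i‖ ≤ C) : ∃ T, IsWeakLimit (l : Filter ι) x T := by
  have key : ∀ ξ η : H, ∃ c : ℂ, Tendsto (fun i => ⟪ξ, x i η⟫_ℂ) l (𝓝 c) ∧
      ‖c‖ ≤ C * ‖ξ‖ * ‖η‖ := by
    intro ξ η
    have hb : ∀ i, ⟪ξ, x i η⟫_ℂ ∈ Metric.closedBall (0 : ℂ) (C * ‖ξ‖ * ‖η‖) := fun i => by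
      rw [mem_closedBall_zero_iff]
      refine (norm_inner_le_norm _ _).trans ?_
      have := (x i).le_of_opNorm_le (h i) η
      nlinarith [norm_nonneg ξ]
    obtain ⟨c, hc, hlim⟩ := (isCompact_closedBall (0 : ℂ) (C * ‖ξ‖ * ‖η‖)).ultrafilter_le_nhds
      (l.map fun i => ⟪ξ, x i η⟫_ℂ) (by
        rw [le_principal_iff]
        exact Filter.mem_map.2 (Filter.univ_mem' hb))
    exact ⟨c, hlim, mem_closedBall_zero_iff.1 hc⟩
  choose B hB hBn using key
  have hl : (l : Filter ι).NeBot := inferInstance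
  let f : H →ₗ⋆[ℂ] H →ₗ[ℂ] ℂ := LinearMap.mk₂'ₛₗ (starRingEnd ℂ) (RingHom.id ℂ) B
    (fun a b c => tendsto_nhds_unique (hB _ _)
      (by simpa only [inner_add_left] using (hB a c).add (hB b c)))
    (fun a b c => tendsto_nhds_unique (hB _ _)
      (by simpa only [inner_smul_left, smul_eq_mul] using (hB b c).const_mul _))
    (fun a b c => tendsto_nhds_unique (hB _ _)
      (by simpa only [map_add, inner_add_right] using (hB a b).add (hB a c)))
    (fun a b c => tendsto_nhds_unique (hB _ _)
      (by simpa only [map_smul, inner_smul_right, smul_eq_mul, RingHom.id_apply] using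
        (hB b c).const_mul a))
  let F : H →L⋆[ℂ] H →L[ℂ] ℂ := f.mkContinuous₂ C hBn
  refine ⟨ContinuousLinearMap.adjoint (InnerProductSpace.continuousLinearMapOfBilin F),
    fun ξ η => ?_⟩
  rw [ContinuousLinearMap.adjoint_inner_right, InnerProductSpace.continuousLinearMapOfBilin_apply]
  exact hB ξ η

end WeakLimit

/-! ### Partial isometries and comparison of projections -/

namespace VonNeumannAlgebra

section Comparison

open Filter Topology
open scoped InnerProductSpace

variable {H : Type u} [NormedAddCommGroup H] [InnerProductSpace ℂ H] [CompleteSpace H]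
  {M : VonNeumannAlgebra H} {ι : Type*}

/-- Convergence of a family in a von Neumann algebra in the weak operator topology. -/
def IsWeakLim (l : Filter ι) (x : ι → M) (T : M) : Prop :=
  IsWeakLimit l (fun i => (x i : H →L[ℂ] H)) T

theorem exists_isWeakLim (l : Ultrafilter ι) (x : ι → M) (C : ℝ) (h : ∀ i, ‖x i‖ ≤ C) :
    ∃ T : M, IsWeakLim (l : Filter ι) x T := by
  obtain ⟨T, hT⟩ := exists_isWeakLimit l (fun i => (x i : H →L[ℂ] H)) C h
  exact ⟨⟨T, hT.mem M (Eventually.of_forall fun i => (x i).2)⟩, hT⟩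

namespace IsWeakLim

variable {l : Filter ι} {x y : ι → M} {S T : M}

theorem unique [l.NeBot] (hS : IsWeakLim l x S) (hT : IsWeakLim l x T) : S = T :=
  Subtype.ext (IsWeakLimit.unique hS hT)

theorem const (T : M) : IsWeakLim l (fun _ => T) T := IsWeakLimit.const _

theorem congr' (hT : IsWeakLim l x T) (h : x =ᶠ[l] y) : IsWeakLim l y T :=
  IsWeakLimit.congr' hT (h.mono fun _ hi => congrArg Subtype.val hi)

theorem eq_of_eventually_eq [l.NeBot] (hT : IsWeakLim l x T) (h : ∀ᶠ i in l, x i = S) : T = S :=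
  (hT.congr' h).unique (const S)

theorem sub (hS : IsWeakLim l x S) (hT : IsWeakLim l y T) :
    IsWeakLim l (fun i => x i - y i) (S - T) := IsWeakLimit.sub hS hT

theorem mul_right (hT : IsWeakLim l x T) (A : M) : IsWeakLim l (fun i => x i * A) (T * A) :=
  IsWeakLimit.mul_right hT _

theorem mul_left (hT : IsWeakLim l x T) (A : M) : IsWeakLim l (fun i => A * x i) (A * T) :=
  IsWeakLimit.mul_left hT _

theorem star (hT : IsWeakLim l x T) : IsWeakLim l (fun i => star (x i)) (star T) :=
  IsWeakLimit.star hT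

theorem norm_le [l.NeBot] (hT : IsWeakLim l x T) {C : ℝ} (hC : 0 ≤ C)
    (h : ∀ᶠ i in l, ‖x i‖ ≤ C) : ‖T‖ ≤ C := IsWeakLimit.norm_le hT hC h

theorem le [l.NeBot] (hS : IsWeakLim l x S) (hT : IsWeakLim l y T)
    (h : ∀ᶠ i in l, x i ≤ y i) : S ≤ T := IsWeakLimit.le hS hT h

end IsWeakLim

theorem _root_.eq_zero_of_star_mul_self {A : Type*} [NonUnitalCStarAlgebra A] {x : A}
    (h : star x * x = 0) : x = 0 := (CStarRing.star_mul_self_eq_zero_iff x).1 h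

theorem _root_.norm_le_one_of_partialIsometry {A : Type*} [NonUnitalCStarAlgebra A] {v : A}
    (hv : v * star v * v = v) : ‖v‖ ≤ 1 := by
  have h1 : ‖star v * v‖ = ‖v‖ * ‖v‖ := CStarRing.norm_star_mul_self
  have h2 : ‖star v * v‖ = ‖star v * v‖ * ‖star v * v‖ := by
    rw [← CStarRing.norm_star_mul_self (x := star v * v), star_mul, star_star, mul_assoc,
      ← mul_assoc v, hv]
  rw [h1] at h2
  by_contra! h
  have h3 : 1 < ‖v‖ * ‖v‖ := by nlinarith
  nlinarith

/-- The witness is `(ε + a)⁻¹`. As `ε → 0` the contractions `a * s` approach the support projection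
of `a`, which makes polar decomposition available by weak limits. -/
theorem _root_.exists_resolvent_of_nonneg {A : Type*} [CStarAlgebra A] [PartialOrder A]
    [StarOrderedRing A] {a : A} (ha : 0 ≤ a) {ε : ℝ} (hε : 0 < ε) :
    ∃ s : A, IsSelfAdjoint s ∧ ‖a * s‖ ≤ 1 ∧ 1 - a * s = ε • s ∧
      ∀ b, Commute b a → Commute b s := by
  have hspec : ∀ x ∈ spectrum ℝ a, 0 ≤ x := fun x hx => spectrum_nonneg_of_nonneg ha hx
  have hcont : ContinuousOn (fun x : ℝ => (ε + x)⁻¹) (spectrum ℝ a) :=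
    (continuousOn_const.add continuousOn_id).inv₀ fun x hx =>
      (add_pos_of_pos_of_nonneg hε (hspec x hx)).ne'
  have ha' : IsSelfAdjoint a := .of_nonneg ha
  have hk : a * cfc (fun x : ℝ => (ε + x)⁻¹) a = cfc (fun x : ℝ => x * (ε + x)⁻¹) a := by
    rw [cfc_mul (fun x => x) _ a continuousOn_id hcont, cfc_id' ℝ a]
  refine ⟨cfc (fun x : ℝ => (ε + x)⁻¹) a, cfc_predicate _ a, ?_, ?_,
    fun b hb => (hb.symm.cfc_real _).symm⟩
  · rw [hk]
    refine norm_cfc_le zero_le_one fun x hx => ?_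
    have h1 := hspec x hx
    rw [Real.norm_of_nonneg (by positivity), ← div_eq_mul_inv, div_le_one (by positivity)]
    linarith
  · rw [hk, ← cfc_const_one ℝ a, ← cfc_sub (fun _ => 1) (fun x => x * (ε + x)⁻¹) a
        continuousOn_const (continuousOn_id.mul hcont),
      ← cfc_smul _ _ a hcont]
    refine cfc_congr fun x hx => ?_
    have : ε + x ≠ 0 := (add_pos_of_pos_of_nonneg hε (hspec x hx)).ne'
    simp only [smul_eq_mul]
    field_simp
    ring

/-- Below every nonzero element there is a nonzero partial isometry, as in its polar
decomposition. -/
theorem exists_partialIsometry (t : M) (ht : t ≠ 0) :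
    ∃ u : M, u ≠ 0 ∧ u * star u * u = u ∧ (∀ a : M, a * t = t → a * u = u) ∧
      ∀ b : M, t * b = t → IsSelfAdjoint b → u * b = u := by
  set a := CFC.abs t with ha
  have ha0 : 0 ≤ a := CFC.abs_nonneg t
  have haa : a * a = star t * t := CFC.abs_mul_abs t
  let ε : ℕ → ℝ := fun n => 1 / (n + 1)
  have hε : ∀ n, 0 < ε n := fun n => Nat.one_div_pos_of_nat
  choose s hs hk_norm hk' hcomm using fun n => exists_resolvent_of_nonneg ha0 (hε n)
  have hs_star : ∀ n, star (s n) = s n := fun n => (hs n).star_eq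
  have hsa : ∀ n, Commute (s n) a := fun n => (hcomm n a (Commute.refl a)).symm
  let k : ℕ → M := fun n => a * s n
  have hak : ∀ n, a - a * k n = ε n • k n := fun n => by
    rw [← mul_one_sub, hk' n, mul_smul_comm]
  let x : ℕ → M := fun n => t * s n
  have hxx : ∀ m n, star (x m) * x n = k m * k n := fun m n => by
    simp only [x, k, star_mul, hs_star, mul_assoc]
    rw [← mul_assoc (star t), ← haa, ← mul_assoc, ← mul_assoc, ← mul_assoc, ← mul_assoc,
      (hsa m).eq]
  have hx_norm : ∀ n, ‖x n‖ ≤ 1 := fun n => by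
    have h1 : ‖x n‖ * ‖x n‖ ≤ 1 := by
      rw [← CStarRing.norm_star_mul_self, hxx]
      exact (norm_mul_le _ _).trans (mul_le_one₀ (hk_norm n) (norm_nonneg _) (hk_norm n))
    nlinarith [norm_nonneg (x n)]
  -- The limit `r` of the `k n` serves as the support projection of `|t|`, and the limit `u` of `t
  -- (ε n + |t|)⁻¹` as the polar part of `t`.
  let L : Ultrafilter ℕ := hyperfilter ℕ
  have hL : (L : Filter ℕ) ≤ atTop := by
    rw [← Nat.cofinite_eq_atTop]; exact hyperfilter_le_cofinite
  obtain ⟨r, hr⟩ := exists_isWeakLim L k 1 hk_norm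
  obtain ⟨u, hu⟩ := exists_isWeakLim L x 1 hx_norm
  have har : a * r = a := by
    refine (sub_eq_zero.1 (norm_le_zero_iff.1 (le_of_forall_pos_le_add fun δ hδ => ?_))).symm
    rw [zero_add]
    refine ((IsWeakLim.const a).sub (hr.mul_left a)).norm_le hδ.le ?_
    filter_upwards [hL (tendsto_one_div_add_atTop_nhds_zero_nat.eventually_le_const hδ)] with n hn
    rw [hak, norm_smul, Real.norm_of_nonneg (hε n).le]
    exact (mul_le_of_le_one_right (hε n).le (hk_norm n)).trans hn
  have hkr : ∀ n, k n * r = k n := fun n => by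
    change a * s n * r = a * s n
    rw [← (hsa n).eq, mul_assoc, har]
  have hrr : r * r = r :=
    (hr.mul_right r).congr' (Eventually.of_forall hkr) |>.unique hr
  have hxr : ∀ n, x n * r = x n := fun n => by
    rw [← sub_eq_zero, ← neg_eq_zero, neg_sub]
    apply eq_zero_of_star_mul_self
    have h0 : k n * (1 - r) = 0 := by rw [mul_sub, mul_one, hkr, sub_self]
    have h1 : x n - x n * r = x n * (1 - r) := by rw [mul_sub, mul_one]
    rw [h1, star_mul, mul_assoc, ← mul_assoc (star (x n)), hxx, mul_assoc (k n), h0, mul_zero,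
      mul_zero]
  have hxu : ∀ m, star (x m) * u = k m := fun m =>
    (((hu.mul_left _).congr' (Eventually.of_forall (hxx m))).unique (hr.mul_left _)).trans (hkr m)
  have huu : star u * u = r :=
    ((hu.star.mul_right u).congr' (Eventually.of_forall hxu)).unique hr
  refine ⟨u, ?_, ?_, ?_, ?_⟩
  · rintro rfl
    apply ht
    apply eq_zero_of_star_mul_self
    rw [← haa, ← har, ← huu]
    simp
  · rw [mul_assoc, huu]
    exact ((hu.mul_right r).congr' (Eventually.of_forall hxr)).unique hu
  · intro b hb
    refine ((hu.mul_left b).congr' (Eventually.of_forall fun n => ?_)).unique hu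
    simp only [x, ← mul_assoc, hb]
  · intro b hb hb'
    refine ((hu.mul_right b).congr' (Eventually.of_forall fun n => ?_)).unique hu
    -- A self-adjoint `b` with `t b = t` commutes with `t⋆t`, hence with `|t|` and its resolvents,
    -- so `b` can be moved next to `t`.
    have h1 : Commute b (star t * t) := by
      have h2 : b * star t = star t := by simpa [hb'.star_eq] using congrArg star hb
      change b * (star t * t) = star t * t * b
      rw [← mul_assoc, h2, mul_assoc, hb]
    have h3 : Commute b a := by
      rw [ha, CFC.abs, CFC.sqrt_eq_cfc]
      exact h1.symm.cfc_nnreal _ |>.symm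
    have h4 : Commute b (s n) := hcomm n b h3
    simp only [x]
    rw [mul_assoc, ← h4.eq, ← mul_assoc, hb]

/-- `w` extends `v` (as partial isometries). -/
def Extends (v w : M) : Prop := w * (star v * v) = v

/-- With `P = v⋆v` and `W = w⋆w`, extension gives `P W P = P`. Since `W` is a projection, `(P - W
P)⋆(P - W P) = P - P W P = 0`. -/
theorem Extends.initial_mul {v w : M} (hv : v * star v * v = v) (hw : w * star w * w = w)
    (h : Extends v w) : star w * w * (star v * v) = star v * v := by
  unfold Extends at h
  have hP : star v * v * (star v * v) = star v * v := by
    rw [mul_assoc, ← mul_assoc v, hv]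
  have hW : star w * w * (star w * w) = star w * w := by
    rw [mul_assoc, ← mul_assoc w, hw]
  have h1 : star v * v * (star w * w) * (star v * v) = star v * v := by
    have : star (w * (star v * v)) * (w * (star v * v)) = star v * v := by rw [h]
    simpa only [star_mul, star_star, mul_assoc] using this
  rw [← sub_eq_zero, ← neg_eq_zero, neg_sub]
  apply eq_zero_of_star_mul_self
  simp only [star_sub, star_mul, star_star]
  have h2 : star v * v * (star w * w) * (star w * w * (star v * v)) = star v * v := by
    rw [← mul_assoc, mul_assoc (star v * v) _ (star w * w), hW, h1]
  rw [sub_mul, mul_sub, mul_sub, hP, h2, h1, ← mul_assoc, h1]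
  simp

theorem Extends.trans {u v w : M} (hu : u * star u * u = u) (hv : v * star v * v = v)
    (h1 : Extends u v) (h2 : Extends v w) : Extends u w := by
  have h := h1.initial_mul hu hv
  unfold Extends at *
  rw [← h, ← mul_assoc, h2, h1]

/-- The upper bound needed for Zorn's lemma is a weak limit point of the chain along its tails. -/
theorem exists_extends_of_chain (p q : M) (c : Set M) (hc : IsChain Extends c)
    (hne : c.Nonempty) (hPI : ∀ v ∈ c, v * star v * v = v ∧ q * v = v ∧ v * p = v) :
    ∃ w : M, (w * star w * w = w ∧ q * w = w ∧ w * p = w) ∧ ∀ v ∈ c, Extends v w := by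
  have hrefl : ∀ v ∈ c, Extends v v := fun v hv => by
    have := (hPI v hv).1
    rwa [mul_assoc] at this
  let l : Filter c := ⨅ v : c, 𝓟 {w : c | Extends v.1 w.1}
  have hl : l.NeBot := by
    have : Nonempty c := hne.to_subtype
    refine iInf_neBot_of_directed ?_ fun v => ?_
    · have hmono : ∀ {a b : c}, Extends a.1 b.1 → 𝓟 {w : c | Extends b.1 w.1} ≤
          𝓟 {w : c | Extends a.1 w.1} := fun {a b} hab =>
        principal_mono.2 fun w hw => hab.trans (hPI a a.2).1 (hPI b b.2).1 hw
      intro a b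
      by_cases hab : (a : M) = b
      · exact ⟨a, le_rfl, (congrArg (fun d : c => 𝓟 {w : c | Extends d.1 w.1})
          (Subtype.ext hab)).le⟩
      · rcases hc a.2 b.2 hab with h | h
        · exact ⟨b, hmono h, le_rfl⟩
        · exact ⟨a, le_rfl, hmono h⟩
    · exact principal_neBot_iff.2 ⟨v, hrefl v v.2⟩
  have hev : ∀ v : c, ∀ᶠ w in l, Extends v.1 (w : c).1 := fun v =>
    mem_iInf_of_mem v (mem_principal_self _)
  let L := Ultrafilter.of l
  have hev' : ∀ v : c, ∀ᶠ w in (L : Filter c), Extends v.1 (w : c).1 := fun v =>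
    Ultrafilter.of_le l (hev v)
  have hn : ∀ v : c, ‖v.1‖ ≤ 1 := fun v => norm_le_one_of_partialIsometry (hPI v v.2).1
  obtain ⟨V, hV⟩ := exists_isWeakLim L (fun v : c => v.1) 1 hn
  have hVP : ∀ v ∈ c, V * (star v * v) = v := fun v hv =>
    (hV.mul_right _).eq_of_eventually_eq (hev' ⟨v, hv⟩)
  have hVs : ∀ v ∈ c, star V * v = star v * v := fun v hv =>
    (hV.star.mul_right _).eq_of_eventually_eq ((hev' ⟨v, hv⟩).mono fun w hw => by
      have h1 := hw.initial_mul (hPI v hv).1 (hPI w w.2).1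
      unfold Extends at hw
      rw [← h1, mul_assoc, hw])
  -- Multiplication is not jointly weakly continuous. Here `V⋆v = v⋆v` for each `v` in the chain, so
  -- separate continuity already identifies the limit of the initial projections as `V⋆V`.
  have hVV : IsWeakLim (L : Filter c) (fun v : c => star v.1 * v.1) (star V * V) :=
    (hV.mul_left (star V)).congr' (Eventually.of_forall fun v => hVs v v.2)
  refine ⟨V, ⟨?_, ?_, ?_⟩, fun v hv => hVP v hv⟩
  · rw [mul_assoc]
    exact ((hVV.mul_left V).congr' (Eventually.of_forall fun v => hVP v v.2)).unique hV
  · exact ((hV.mul_left q).congr' (Eventually.of_forall fun v => (hPI v v.2).2.1)).unique hV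
  · exact ((hV.mul_right p).congr' (Eventually.of_forall fun v => (hPI v v.2).2.2)).unique hV

/-- Elements `e`, `f` of a von Neumann algebra with `f M e = 0` are separated by a central
projection. -/
theorem exists_central_projection (e f : M) (h : ∀ m : M, f * m * e = 0) :
    ∃ c : M, c ∈ Set.center M ∧ IsStarProjection c ∧ c * e = e ∧ f * c = 0 := by
  -- The closure of `M e H` is invariant under both `M` and `M'`, so its projection lies in `M' ∩
  -- M`. It contains the range of `e` and is killed by `f`.
  let K₀ : Submodule ℂ H := Submodule.span ℂ {ξ | ∃ (m : M) (η : H), (m : H →L[ℂ] H) (e.1 η) = ξ}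
  let K := K₀.topologicalClosure
  have : CompleteSpace K := K₀.isClosed_topologicalClosure.completeSpace_coe
  have hinv : ∀ y : H →L[ℂ] H, (∀ ξ ∈ {ξ | ∃ (m : M) (η : H), (m : H →L[ℂ] H) (e.1 η) = ξ},
      y ξ ∈ K₀) → K.starProjection.range ∈ Module.End.invtSubmodule y := by
    intro y hy
    rw [Submodule.range_starProjection, Module.End.mem_invtSubmodule_iff_map_le]
    have h0 : K₀ ≤ K₀.comap (y : H →ₗ[ℂ] H) := Submodule.span_le.2 hy
    exact (Submodule.topologicalClosure_map (s := K₀) y).trans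
      (Submodule.topologicalClosure_mono (Submodule.map_le_iff_le_comap.2 h0))
  have hproj : IsStarProjection K.starProjection := isStarProjection_starProjection
  have hM : K.starProjection ∈ M := by
    rw [IsStarProjection.mem_iff hproj]
    refine fun y hy => hinv y ?_
    rintro _ ⟨m, η, rfl⟩
    rw [mem_commutant_iff] at hy
    refine Submodule.subset_span ⟨m, y η, ?_⟩
    have := congrArg (fun T : H →L[ℂ] H => T η) (hy (m * e).1 (m * e).2)
    exact this
  have hM' : K.starProjection ∈ M.commutant := by
    rw [IsStarProjection.mem_iff hproj, commutant_commutant]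
    refine fun y hy => hinv y ?_
    rintro _ ⟨m, η, rfl⟩
    exact Submodule.subset_span ⟨⟨y, hy⟩ * m, η, rfl⟩
  refine ⟨⟨_, hM⟩, ?_, ⟨Subtype.ext hproj.1, Subtype.ext hproj.2⟩, Subtype.ext ?_, Subtype.ext ?_⟩
  · rw [← coe_mem_center_iff]
    exact ⟨hM, hM'⟩
  · ext η
    exact Submodule.starProjection_eq_self_iff.2
      (K₀.le_topologicalClosure (Submodule.subset_span ⟨1, η, rfl⟩))
  · ext η
    have h0 : K₀ ≤ (f : H →L[ℂ] H).ker := Submodule.span_le.2 (by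
      rintro _ ⟨m, η, rfl⟩
      exact congrArg (fun T : M => (T : H →L[ℂ] H) η) (h m))
    have h1 : K ≤ (f : H →L[ℂ] H).ker :=
      K₀.topologicalClosure_minimal h0 (f : H →L[ℂ] H).isClosed_ker
    exact h1 (K.starProjection_apply_mem η)

/-- The comparison theorem for projections. -/
theorem comparison (p q : M) (hp : IsStarProjection p) (hq : IsStarProjection q) :
    ∃ v c : M, c ∈ Set.center M ∧ IsStarProjection c ∧ q * v = v ∧ v * p = v ∧
      c * (p - star v * v) = p - star v * v ∧ (q - v * star v) * c = 0 := by
  let S : Set M := {v | v * star v * v = v ∧ q * v = v ∧ v * p = v}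
  have : Nonempty S := ⟨⟨0, by simp [S]⟩⟩
  obtain ⟨⟨v, hv, hqv, hvp⟩, hmax⟩ := exists_maximal_of_nonempty_chains_bounded
      (r := fun v w : S => Extends v.1 w.1) (fun c hc hne => by
    obtain ⟨w, hw, hub⟩ := exists_extends_of_chain p q (Subtype.val '' c)
      (by
        rintro _ ⟨a, ha, rfl⟩ _ ⟨b, hb, rfl⟩ hab
        exact hc ha hb fun h => hab (congrArg _ h))
      (hne.image _) (by rintro _ ⟨a, -, rfl⟩; exact a.2)
    exact ⟨⟨w, hw⟩, fun a ha => hub a ⟨a, ha, rfl⟩⟩)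
    (fun {a b c} hab hbc => hab.trans a.2.1 b.2.1 hbc)
  have hvq : star v * q = star v := by
    simpa only [star_mul, hq.isSelfAdjoint.star_eq] using congrArg star hqv
  have hpv : p * star v = star v := by
    simpa only [star_mul, hp.isSelfAdjoint.star_eq] using congrArg star hvp
  have hv' : star v * v * star v = star v := by
    simpa only [star_mul, star_star, mul_assoc] using congrArg star hv
  set e := p - star v * v with he
  set f := q - v * star v with hf
  have hev : e * star v = 0 := by rw [he, sub_mul, hpv, hv', sub_self]
  have hve : v * e = 0 := by rw [he, mul_sub, hvp, ← mul_assoc, hv, sub_self]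
  have hvf : star v * f = 0 := by rw [hf, mul_sub, hvq, ← mul_assoc, hv', sub_self]
  have hee : e * e = e := by
    nth_rw 2 [he]
    rw [mul_sub, ← mul_assoc, hev, zero_mul, sub_zero, he, sub_mul, hp.isIdempotentElem.eq,
      mul_assoc, hvp]
  have hff : f * f = f := by
    nth_rw 1 [hf]
    rw [sub_mul, mul_assoc v, hvf, mul_zero, sub_zero, hf, mul_sub, hq.isIdempotentElem.eq,
      ← mul_assoc, hqv]
  have hep : e * p = e := by rw [he, sub_mul, hp.isIdempotentElem.eq, mul_assoc, hvp]
  have hqf : q * f = f := by rw [hf, mul_sub, hq.isIdempotentElem.eq, ← mul_assoc, hqv]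
  have hes : IsSelfAdjoint e := hp.isSelfAdjoint.sub (.star_mul_self v)
  -- Otherwise the polar part `u` of `f m e` lives between the leftovers `e` and `f`, and `v + u`
  -- properly extends the maximal `v`.
  have hfe : ∀ m : M, f * m * e = 0 := by
    intro m
    by_contra hne
    obtain ⟨u, hu0, hu, hul, hur⟩ := exists_partialIsometry _ hne
    have hfu : f * u = u := hul _ (by rw [← mul_assoc, ← mul_assoc, hff])
    have hue : u * e = u := hur _ (by rw [mul_assoc, hee]) hes
    have huv : u * star v = 0 := by rw [← hue, mul_assoc, hev, mul_zero]
    have hvu : star v * u = 0 := by rw [← hfu, ← mul_assoc, hvf, zero_mul]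
    have huv' : v * star u = 0 := by simpa using congrArg star huv
    have hvu' : star u * v = 0 := by simpa using congrArg star hvu
    have hww : star (v + u) * (v + u) = star v * v + star u * u := by
      rw [star_add, add_mul, mul_add, mul_add, hvu, hvu', add_zero, zero_add]
    have hvw : v * (star (v + u) * (v + u)) = v := by
      rw [hww, mul_add, ← mul_assoc, hv, ← mul_assoc, huv', zero_mul, add_zero]
    have huw : u * (star (v + u) * (v + u)) = u := by
      rw [hww, mul_add, ← mul_assoc, huv, zero_mul, zero_add, ← mul_assoc, hu]
    have hw : v + u ∈ S := by
      refine ⟨?_, ?_, ?_⟩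
      · rw [mul_assoc, add_mul, hvw, huw]
      · rw [mul_add, hqv, ← hfu, ← mul_assoc, hqf]
      · rw [add_mul, hvp, ← hue, mul_assoc, hep]
    have hext := hmax ⟨v + u, hw⟩ (by
      change (v + u) * (star v * v) = v
      rw [add_mul, ← mul_assoc, hv, ← mul_assoc, huv, zero_mul, add_zero])
    have h2 : v * (star (v + u) * (v + u)) = v + u := hext
    rw [hvw] at h2
    exact hu0 (by simpa using h2)
  obtain ⟨c, hc, hc', hce, hfc⟩ := exists_central_projection e f hfe
  exact ⟨v, c, hc, hc', hqv, hvp, hce, hfc⟩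

end Comparison

end VonNeumannAlgebra

/-! ### Lifting central elements through a closed ideal -/

theorem IsSelfAdjoint.norm_le_of_neg_le_of_le {A : Type*} [CStarAlgebra A] [PartialOrder A]
    [StarOrderedRing A] {y : A} (hy : IsSelfAdjoint y) {r : ℝ} (hr : 0 ≤ r)
    (h1 : -algebraMap ℝ A r ≤ y) (h2 : y ≤ algebraMap ℝ A r) : ‖y‖ ≤ r := by
  rw [← cfc_id' ℝ y]
  rw [← map_neg, algebraMap_le_iff_le_spectrum] at h1
  rw [le_algebraMap_iff_spectrum_le] at h2
  exact norm_cfc_le hr fun x hx => abs_le.2 ⟨h1 x hx, h2 x hx⟩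

/-- The part of a positive element of norm at most `r` on a central projection `c` lies between
`0` and `r c`. -/
theorem mul_central_projection_le {A : Type*} [CStarAlgebra A] [PartialOrder A]
    [StarOrderedRing A] {g c : A} (hg : 0 ≤ g) {r : ℝ} (hr : ‖g‖ ≤ r) (hc : c ∈ Set.center A)
    (hc' : IsStarProjection c) : 0 ≤ g * c ∧ g * c ≤ r • c := by
  have key : ∀ y : A, c * y * star c = y * c := fun y => by
    rw [hc'.isSelfAdjoint.star_eq, (Semigroup.mem_center_iff.1 hc y).symm, mul_assoc,
      hc'.isIdempotentElem.eq]
  have h1 : g ≤ algebraMap ℝ A r :=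
    (IsSelfAdjoint.of_nonneg hg).le_algebraMap_norm_self.trans (algebraMap_mono A hr)
  constructor
  · rw [← key]
    exact star_right_conjugate_nonneg hg c
  · have h2 := star_right_conjugate_nonneg (sub_nonneg.2 h1) c
    rw [key, sub_mul, sub_nonneg, Algebra.algebraMap_eq_smul_one, smul_mul_assoc, one_mul] at h2
    exact h2

/-- On `c` and `1 - c`, for a central projection `c`, elements `g` and `- h` are approximated by
the midpoints of `[0, r]` and `[-r, 0]`. -/
theorem exists_central_add_of_projection {A : Type*} [CStarAlgebra A] [PartialOrder A]
    [StarOrderedRing A] {g h c : A} (hpos : 0 ≤ g) (hneg : 0 ≤ h) {r : ℝ} (hposn : ‖g‖ ≤ r)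
    (hnegn : ‖h‖ ≤ r) (hc : c ∈ Set.center A) (hc' : IsStarProjection c) :
    ∃ z y : A, z ∈ Set.center A ∧ ‖z‖ ≤ r ∧ IsSelfAdjoint y ∧ ‖y‖ ≤ r / 2 ∧
      z + y = g * c - h * (1 - c) := by
  have hr0 : 0 ≤ r := (norm_nonneg g).trans hposn
  have hc1 : IsStarProjection (1 - c) := hc'.one_sub
  have hc1c : 1 - c ∈ Set.center A := (Subring.center A).sub_mem (one_mem _) hc
  obtain ⟨hg1, hg2⟩ := mul_central_projection_le hpos hposn hc hc'
  obtain ⟨hh1, hh2⟩ := mul_central_projection_le hneg hnegn hc1c hc1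
  let z : A := (r / 2) • (c - (1 - c))
  let y : A := g * c - h * (1 - c) - z
  have hzc : z ∈ Set.center A :=
    (Subalgebra.center ℝ A).smul_mem ((Subring.center A).sub_mem hc hc1c) _
  have hzs : IsSelfAdjoint z := .smul (.all _) (hc'.isSelfAdjoint.sub hc1.isSelfAdjoint)
  have hr1 : algebraMap ℝ A (r / 2) = (r / 2) • c + (r / 2) • (1 - c) := by
    rw [Algebra.algebraMap_eq_smul_one, ← smul_add, add_sub_cancel]
  have hrc : ∀ d : A, r • d = (r / 2) • d + (r / 2) • d := fun d => by
    rw [← add_smul, add_halves]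
  have hys : IsSelfAdjoint y := ((IsSelfAdjoint.of_nonneg hg1).sub (.of_nonneg hh1)).sub hzs
  refine ⟨z, y, hzc, ?_, hys, ?_, add_sub_cancel _ _⟩
  · refine (hzs.norm_le_of_neg_le_of_le (r := r / 2) (by positivity) ?_ ?_).trans (by linarith)
    · rw [hr1, ← sub_nonneg]
      have : z - -((r / 2) • c + (r / 2) • (1 - c)) = r • c := by
        simp only [z, smul_sub, hrc]
        abel
      rw [this]
      exact smul_nonneg hr0 hc'.nonneg
    · rw [hr1, ← sub_nonneg]
      have : (r / 2) • c + (r / 2) • (1 - c) - z = r • (1 - c) := by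
        simp only [z, hrc]
        rw [smul_sub (r / 2) c]
        abel
      rw [this]
      exact smul_nonneg hr0 hc1.nonneg
  · refine hys.norm_le_of_neg_le_of_le (by positivity) ?_ ?_
    · rw [hr1, ← sub_nonneg]
      rw [hrc] at hh2
      have : y - -((r / 2) • c + (r / 2) • (1 - c)) =
        g * c + ((r / 2) • (1 - c) + (r / 2) • (1 - c) - h * (1 - c)) := by
        simp only [y, z, smul_sub]
        abel
      rw [this]
      exact add_nonneg hg1 (sub_nonneg.2 hh2)
    · rw [hr1, ← sub_nonneg]
      rw [hrc] at hg2
      have : (r / 2) • c + (r / 2) • (1 - c) - y =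
        ((r / 2) • c + (r / 2) • c - g * c) + h * (1 - c) := by
        simp only [y, z, smul_sub]
        abel
      rw [this]
      exact add_nonneg (sub_nonneg.2 hg2) hh1

namespace VonNeumannAlgebra

section CentralLifting

variable {H : Type u} [NormedAddCommGroup H] [InnerProductSpace ℂ H] [CompleteSpace H]
  {M : VonNeumannAlgebra H}

/-- The projection onto the kernel of an element of `M` lies in `M`. -/
theorem exists_kernel_projection (y : M) :
    ∃ p : M, IsStarProjection p ∧ y * p = 0 ∧ ∀ x : M, y * x = 0 → p * x = x := by
  let K : Submodule ℂ H := (y : H →L[ℂ] H).ker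
  have : CompleteSpace K := (y : H →L[ℂ] H).isClosed_ker.completeSpace_coe
  have hproj : IsStarProjection K.starProjection := isStarProjection_starProjection
  have hM : K.starProjection ∈ M := by
    rw [IsStarProjection.mem_iff hproj]
    intro g hg
    rw [Submodule.range_starProjection, Module.End.mem_invtSubmodule_iff_forall_mem_of_mem]
    intro ξ hξ
    rw [mem_commutant_iff] at hg
    have h := congrArg (fun T : H →L[ℂ] H => T ξ) (hg y y.2)
    have hξ' : (y : H →L[ℂ] H) ξ = 0 := hξ
    change (y : H →L[ℂ] H) (g ξ) = 0
    exact h.trans ((congrArg g hξ').trans (map_zero g))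
  refine ⟨⟨_, hM⟩, ⟨Subtype.ext hproj.1, Subtype.ext hproj.2⟩, Subtype.ext ?_, fun x hx =>
    Subtype.ext ?_⟩
  · ext ξ
    exact K.starProjection_apply_mem ξ
  · ext ξ
    exact Submodule.starProjection_eq_self_iff.2 (congrArg (fun T : M => (T : H →L[ℂ] H) ξ) hx)

/-- The elements of `M` that are central modulo a ⋆-closed ideal. -/
def centralMod (I : Ideal M) [I.IsTwoSided] (hstar : ∀ x ∈ I, star x ∈ I) :
    StarSubalgebra ℂ M where
  carrier := {x | ∀ m : M, x * m - m * x ∈ I}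
  mul_mem' {x y} hx hy m := by
    have h1 := I.mul_mem_left x (hy m)
    have h2 := I.mul_mem_right y (hx m)
    have : x * y * m - m * (x * y) = x * (y * m - m * y) + (x * m - m * x) * y := by
      noncomm_ring
    rw [this]
    exact I.add_mem h1 h2
  add_mem' {x y} hx hy m := by
    have : (x + y) * m - m * (x + y) = (x * m - m * x) + (y * m - m * y) := by noncomm_ring
    rw [this]
    exact I.add_mem (hx m) (hy m)
  algebraMap_mem' r m := by
    rw [Algebra.commutes, sub_self]
    exact I.zero_mem
  star_mem' {x} hx m := by
    have h := hstar _ (hx (star m))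
    rw [star_sub, star_mul, star_mul, star_star] at h
    rw [← neg_sub]
    exact I.neg_mem h

variable {I : Ideal M} [I.IsTwoSided] {hstar : ∀ x ∈ I, star x ∈ I}

theorem isClosed_centralMod (hI : IsClosed (I : Set M)) :
    IsClosed (centralMod I hstar : Set M) := by
  have : (centralMod I hstar : Set M) = ⋂ m : M, (fun x => x * m - m * x) ⁻¹' (I : Set M) := by
    ext x
    simp only [Set.mem_iInter]
    exact Iff.rfl
  rw [this]
  exact isClosed_iInter fun m => hI.preimage (by fun_prop)

theorem mem_centralMod_of_mem_center {z : M} (hz : z ∈ Set.center M) :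
    z ∈ centralMod I hstar := fun m => by
  rw [Semigroup.mem_center_iff.1 hz m, sub_self]
  exact I.zero_mem

/-- Two orthogonal positive elements that are central modulo `I` are separated by a central
projection, modulo `I`. -/
theorem exists_central_projection_mod {g h : M} (hg : IsSelfAdjoint g) (hh : IsSelfAdjoint h)
    (hhg : h * g = 0) (hgI : g ∈ centralMod I hstar) (hhI : h ∈ centralMod I hstar) :
    ∃ c ∈ Set.center M, IsStarProjection c ∧ g * (1 - c) ∈ I ∧ h * c ∈ I := by
  obtain ⟨p, hp, hhp, hker⟩ := exists_kernel_projection h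
  have hpg : p * g = g := hker g hhg
  have hgp : g * p = g := by
    simpa [hg.star_eq, hp.isSelfAdjoint.star_eq] using congrArg star hpg
  have hph : p * h = 0 := by
    simpa [hh.star_eq, hp.isSelfAdjoint.star_eq] using congrArg star hhp
  obtain ⟨v, c, hc, hc', hqv, hvp, hce, hfc⟩ := comparison p (1 - p) hp hp.one_sub
  have hcc := Semigroup.mem_center_iff.1 hc
  have hgv : g * v = 0 := by rw [← hqv, ← mul_assoc, mul_sub, mul_one, hgp, sub_self, zero_mul]
  have hhv : v * h = 0 := by rw [← hvp, mul_assoc, hph, mul_zero]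
  refine ⟨c, hc, hc', ?_, ?_⟩
  · have h1 : g * (star v * v) ∈ I := by
      have := I.mul_mem_right v (hgI (star v))
      rwa [sub_mul, mul_assoc (star v), hgv, mul_zero, sub_zero, mul_assoc] at this
    -- Comparison puts `p - v⋆v` under `c`, so `p` and `v⋆v` agree on `1 - c`. Symmetrically, `1 -
    -- p` and `v v⋆` agree on `c` below.
    have h2 : g * (1 - c) = g * (star v * v) * (1 - c) := by
      have h3 : (p - star v * v) * (1 - c) = 0 := by
        rw [mul_sub, mul_one, hcc, hce, sub_self]
      rw [sub_mul, sub_eq_zero] at h3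
      rw [mul_assoc, ← h3, ← mul_assoc, hgp]
    rw [h2]
    exact I.mul_mem_right _ h1
  · have h1 : h * (v * star v) ∈ I := by
      have := I.mul_mem_right (star v) (hhI v)
      rwa [hhv, sub_zero, mul_assoc] at this
    have h2 : h * c = h * (v * star v) * c := by
      rw [sub_mul, sub_eq_zero] at hfc
      rw [mul_assoc, ← hfc, ← mul_assoc, mul_sub, mul_one, hhp, sub_zero]
    rw [h2]
    exact I.mul_mem_right _ h1

/-- The halving step. Being central modulo `I` passes to `x⁺` and `x⁻` by functional calculus, as
`centralMod` is a closed ⋆-subalgebra, and it passes to the remainder `y`, so the step can be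
repeated. -/
theorem exists_central_sub_of_selfAdjoint (hI : IsClosed (I : Set M)) (x : M)
    (hx : IsSelfAdjoint x) (hxI : x ∈ centralMod I hstar) :
    ∃ z y : M, z ∈ Set.center M ∧ ‖z‖ ≤ ‖x‖ ∧ IsSelfAdjoint y ∧ y ∈ centralMod I hstar ∧
      ‖y‖ ≤ ‖x‖ / 2 ∧ x - z - y ∈ I := by
  have : IsClosed (centralMod I hstar : Set M) := isClosed_centralMod hI
  have hpos : 0 ≤ x⁺ := CFC.posPart_nonneg x
  have hneg : 0 ≤ x⁻ := CFC.negPart_nonneg x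
  obtain ⟨c, hc, hc', hgI, hhI⟩ := exists_central_projection_mod (I := I) (hstar := hstar)
    (IsSelfAdjoint.of_nonneg hpos) (IsSelfAdjoint.of_nonneg hneg) (CFC.negPart_mul_posPart x)
    (cfcₙ_mem (𝕜 := ℝ) (𝕜' := ℂ) _ hxI) (cfcₙ_mem (𝕜 := ℝ) (𝕜' := ℂ) _ hxI)
  obtain ⟨z, y, hz, hzn, hy, hyn, hzy⟩ := exists_central_add_of_projection hpos hneg
    (CStarAlgebra.norm_posPart_le x) (CStarAlgebra.norm_negPart_le x) hc hc'
  have hI' : x - z - y ∈ I := by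
    have : x - z - y = x⁺ * (1 - c) - x⁻ * c := by
      rw [sub_sub, hzy]
      nth_rw 1 [← CFC.posPart_sub_negPart x hx]
      noncomm_ring
    rw [this]
    exact I.sub_mem hgI hhI
  refine ⟨z, y, hz, hzn, hy, ?_, hyn, hI'⟩
  have h1 : x - z - (x - z - y) = y := by abel
  rw [← h1]
  exact sub_mem (sub_mem hxI (mem_centralMod_of_mem_center hz)) fun m =>
    I.sub_mem (I.mul_mem_right _ hI') (I.mul_mem_left _ hI')

/-- Repeated halving writes `x` modulo `I` as a partial sum of central elements plus a remainder of
norm at most `‖x‖ / 2 ^ n`. The series converges, and closedness of `I` and of the center passes to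
the limit. -/
theorem exists_central_of_mem_centralMod_of_selfAdjoint (hI : IsClosed (I : Set M)) (x : M)
    (hx : IsSelfAdjoint x) (hxI : x ∈ centralMod I hstar) : ∃ z ∈ Set.center M, x - z ∈ I := by
  choose z y hz hzn hy hyI hyn hI' using fun x : {x : M // IsSelfAdjoint x ∧
    x ∈ centralMod I hstar} => exists_central_sub_of_selfAdjoint hI x.1 x.2.1 x.2.2
  let s : ℕ → {x : M // IsSelfAdjoint x ∧ x ∈ centralMod I hstar} :=
    fun n => Nat.rec ⟨x, hx, hxI⟩ (fun _ w => ⟨y w, hy w, hyI w⟩) n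
  have hs : ∀ n, ‖(s n).1‖ ≤ ‖x‖ * (1 / 2) ^ n := by
    intro n
    induction n with
    | zero => simp [s]
    | succ n ih =>
      have := hyn (s n)
      change ‖y (s n)‖ ≤ _
      rw [pow_succ]
      linarith
  have hsum : Summable fun n => z (s n) :=
    Summable.of_norm_bounded ((summable_geometric_two).mul_left ‖x‖)
      fun n => (hzn _).trans (hs n)
  have hfin : ∀ n, x - ∑ i ∈ Finset.range n, z (s i) - (s n).1 ∈ I := by
    intro n
    induction n with
    | zero => simp [s]
    | succ n ih =>
      have h1 : x - ∑ i ∈ Finset.range (n + 1), z (s i) - (s (n + 1)).1 =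
          (x - ∑ i ∈ Finset.range n, z (s i) - (s n).1) + ((s n).1 - z (s n) - y (s n)) := by
        rw [Finset.sum_range_succ]
        change _ - _ - y (s n) = _
        abel
      rw [h1]
      exact I.add_mem ih (hI' _)
  have hs0 : Filter.Tendsto (fun n => (s n).1) Filter.atTop (nhds 0) := by
    refine squeeze_zero_norm hs ?_
    simpa using (tendsto_pow_atTop_nhds_zero_of_lt_one (r := (1 / 2 : ℝ)) (by norm_num)
      (by norm_num)).const_mul ‖x‖
  have hlim := hsum.hasSum.tendsto_sum_nat
  refine ⟨∑' n, z (s n), ?_, ?_⟩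
  · have hcl : IsClosed (Set.center M) := by
      rw [← Set.centralizer_univ]
      exact Set.isClosed_centralizer _
    exact hcl.mem_of_tendsto hlim (Filter.Eventually.of_forall fun n =>
      (Subring.center M).sum_mem fun i _ => hz _)
  · have := (hlim.const_sub x).sub hs0
    rw [sub_zero] at this
    exact hI.mem_of_tendsto this (Filter.Eventually.of_forall hfin)

/-- The center of the quotient of a von Neumann algebra by a closed ideal is the image of the
center. -/
theorem exists_central_of_mem_centralMod (hI : IsClosed (I : Set M)) (x : M)
    (hxI : x ∈ centralMod I hstar) : ∃ z ∈ Set.center M, x - z ∈ I := by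
  have hmem : ∀ a : M, a ∈ centralMod I hstar → IsSelfAdjoint a → ∃ z ∈ Set.center M, a - z ∈ I :=
    fun a ha hs => exists_central_of_mem_centralMod_of_selfAdjoint hI a hs ha
  have h1 : (realPart x : M) ∈ centralMod I hstar := by
    rw [realPart_apply_coe, ← Complex.coe_smul]
    exact SMulMemClass.smul_mem _ (add_mem hxI (star_mem hxI))
  have h2 : (imaginaryPart x : M) ∈ centralMod I hstar := by
    rw [imaginaryPart_apply_coe, ← Complex.coe_smul]
    exact SMulMemClass.smul_mem _ (SMulMemClass.smul_mem _ (sub_mem hxI (star_mem hxI)))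
  obtain ⟨z₁, hz₁, h₁⟩ := hmem _ h1 (realPart x).2
  obtain ⟨z₂, hz₂, h₂⟩ := hmem _ h2 (imaginaryPart x).2
  refine ⟨z₁ + Complex.I • z₂, Set.add_mem_center hz₁
    ((Subalgebra.center ℂ M).smul_mem hz₂ _), ?_⟩
  have h3 : Complex.I • ((imaginaryPart x : M) - z₂) ∈ I := by
    rw [← smul_one_mul]
    exact I.mul_mem_left _ h₂
  have h4 : x - (z₁ + Complex.I • z₂) =
      ((realPart x : M) - z₁) + Complex.I • ((imaginaryPart x : M) - z₂) := by
    conv_lhs => rw [← realPart_add_I_smul_imaginaryPart x]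
    rw [smul_sub]
    abel
  rw [h4]
  exact I.add_mem h₁ h3

end CentralLifting

end VonNeumannAlgebra

/-! ### The center of the ultrafiber -/

namespace VonNeumannAlgebra

namespace TracialCondExp

section Center

variable {H : Type u} [NormedAddCommGroup H] [InnerProductSpace ℂ H] [CompleteSpace H]
  {M N : VonNeumannAlgebra H} (E : TracialCondExp M N) (U : N →ₐ[ℂ] ℂ)

theorem isClosed_ultrafiberIdeal : IsClosed (E.ultrafiberIdeal U : Set M) := by
  have h : Continuous (E.functional U) := map_continuous (E.functional U)
  have : (E.ultrafiberIdeal U : Set M) = (fun x => E.functional U (star x * x)) ⁻¹' {0} := rfl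
  rw [this]
  exact isClosed_singleton.preimage (h.comp (by fun_prop))

namespace Ultrafiber

theorem mk_eq_zero_iff {x : M} : mk E U x = 0 ↔ x ∈ E.ultrafiberIdeal U := by
  rw [← map_zero (mk E U), mk_eq_mk_iff, sub_zero]

theorem center_eq : Set.center (E.Ultrafiber U) = mk E U '' Set.center M := by
  ext a
  constructor
  · intro ha
    obtain ⟨x, rfl⟩ := mk_surjective E U a
    have hx : x ∈ centralMod (E.ultrafiberIdeal U)
        (fun _ h => star_mem_ultrafiberIdeal h) := fun m => by
      rw [← mk_eq_mk_iff, map_mul, map_mul]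
      exact (Semigroup.mem_center_iff.1 ha _).symm
    obtain ⟨z, hz, hxz⟩ := exists_central_of_mem_centralMod (E.isClosed_ultrafiberIdeal U) x hx
    exact ⟨z, hz, ((mk_eq_mk_iff E U).2 hxz).symm⟩
  · rintro ⟨z, hz, rfl⟩
    rw [Semigroup.mem_center_iff] at hz ⊢
    intro b
    obtain ⟨y, rfl⟩ := mk_surjective E U b
    rw [← map_mul, hz, map_mul]

/-- The ⋆-homomorphism from the ultrafiber of the center to the ultrafiber. -/
noncomputable def ofCenter (hN : N ≤ M.center) :
    (E.restrictCenter hN).Ultrafiber U →⋆ₐ[ℂ] E.Ultrafiber U where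
  toAlgHom := Ideal.Quotient.liftₐ ((E.restrictCenter hN).ultrafiberIdeal U)
    ((mk E U).comp (inclusion M.center_le).toAlgHom) fun _ ha => (mk_eq_zero_iff E U).2 ha
  map_star' a := by
    obtain ⟨x, rfl⟩ := mk_surjective _ U a
    rfl

theorem ofCenter_mk (hN : N ≤ M.center) (z : M.center) :
    ofCenter E U hN (mk (E.restrictCenter hN) U z) = mk E U (inclusion M.center_le z) := rfl

theorem ofCenter_injective (hN : N ≤ M.center) : Function.Injective (ofCenter E U hN) := by
  rw [injective_iff_map_eq_zero]
  intro a ha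
  obtain ⟨x, rfl⟩ := mk_surjective _ U a
  rw [ofCenter_mk, mk_eq_zero_iff, mem_ultrafiberIdeal] at ha
  rw [mk_eq_zero_iff, mem_ultrafiberIdeal]
  exact ha

theorem range_ofCenter (hN : N ≤ M.center) :
    Set.range (ofCenter E U hN) = Set.center (E.Ultrafiber U) := by
  rw [center_eq]
  ext a
  constructor
  · rintro ⟨b, rfl⟩
    obtain ⟨z, rfl⟩ := mk_surjective _ U b
    exact ⟨inclusion M.center_le z, coe_mem_center_iff.1 z.2, rfl⟩
  · rintro ⟨z, hz, rfl⟩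
    exact ⟨mk (E.restrictCenter hN) U ⟨z, coe_mem_center_iff.2 hz⟩, rfl⟩

/-- The ultrafiber of the center is the center of the ultrafiber. -/
noncomputable def centerEquiv (hN : N ≤ M.center) :
    (E.restrictCenter hN).Ultrafiber U ≃⋆ₐ[ℂ]
      NonUnitalStarSubalgebra.center ℂ (E.Ultrafiber U) :=
  StarAlgEquiv.ofBijective
    (NonUnitalStarAlgHom.codRestrict (ofCenter E U hN)
      (NonUnitalStarSubalgebra.center ℂ (E.Ultrafiber U)) fun a => by
        rw [← SetLike.mem_coe, NonUnitalStarSubalgebra.coe_center, ← range_ofCenter E U hN]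
        exact ⟨a, rfl⟩)
    ⟨fun a b h => ofCenter_injective E U hN (congrArg Subtype.val h), fun b => by
      have hb := b.2
      rw [← SetLike.mem_coe, NonUnitalStarSubalgebra.coe_center, ← range_ofCenter E U hN] at hb
      obtain ⟨a, ha⟩ := hb
      exact ⟨a, Subtype.ext ha⟩⟩

theorem coe_centerEquiv (hN : N ≤ M.center) (a : (E.restrictCenter hN).Ultrafiber U) :
    (centerEquiv E U hN a : E.Ultrafiber U) = ofCenter E U hN a := rfl

theorem trace_ofCenter (hN : N ≤ M.center) (a : (E.restrictCenter hN).Ultrafiber U) :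
    trace E U (ofCenter E U hN a) = trace (E.restrictCenter hN) U a := by
  obtain ⟨z, rfl⟩ := mk_surjective _ U a
  rfl

theorem map_one_eq : E.toLinearMap 1 = 1 := E.apply_of_mem 1

theorem nontrivial : Nontrivial (E.Ultrafiber U) := by
  refine nontrivial_of_ne 1 0 fun h => ?_
  rw [← map_one (mk E U), mk_eq_zero_iff, mem_ultrafiberIdeal, star_one, one_mul, map_one_eq,
    map_one] at h
  exact one_ne_zero h

theorem inclusion_mem_ultrafiberIdeal {n : N} (hn : U n = 0) :
    inclusion E.le n ∈ E.ultrafiberIdeal U := by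
  rw [mem_ultrafiberIdeal, ← map_star, ← map_mul, E.apply_of_mem, map_mul, hn, mul_zero]

/-- The element `n - 𝒰 n` is in the kernel of the character, and multiplicativity of `𝒰` puts that
kernel inside the ideal. -/
theorem mk_inclusion (n : N) : mk E U (inclusion E.le n) = algebraMap ℂ _ (U n) := by
  rw [← AlgHom.commutes (mk E U), mk_eq_mk_iff]
  have : inclusion E.le n - algebraMap ℂ M (U n) = inclusion E.le (n - algebraMap ℂ N (U n)) := rfl
  rw [this]
  apply inclusion_mem_ultrafiberIdeal
  rw [map_sub, AlgHom.commutes, Algebra.algebraMap_self_apply, sub_self]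

theorem center_eq_scalars (hN : N = M.center) :
    Set.center (E.Ultrafiber U) = Set.range (algebraMap ℂ (E.Ultrafiber U)) := by
  refine Set.Subset.antisymm ?_ ?_
  · rw [center_eq]
    rintro _ ⟨z, hz, rfl⟩
    have hz' : (z : H →L[ℂ] H) ∈ N := hN ▸ coe_mem_center_iff.2 hz
    exact ⟨U ⟨z, hz'⟩, (mk_inclusion E U ⟨z, hz'⟩).symm⟩
  · rintro _ ⟨c, rfl⟩
    exact (Subalgebra.center ℂ _).algebraMap_mem c

end Ultrafiber

end Center

end TracialCondExp

end VonNeumannAlgebra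

/-! ### Order estimates for `(1 + s)⁻¹` -/

section Resolvent

variable {A : Type*} [CStarAlgebra A] [PartialOrder A] [StarOrderedRing A]

theorem isUnit_one_add_of_nonneg {s : A} (hs : 0 ≤ s) : IsUnit (1 + s) :=
  CStarAlgebra.isUnit_of_le 1 (le_add_of_nonneg_right hs)

theorem inverse_one_add_nonneg {s : A} (hs : 0 ≤ s) : 0 ≤ Ring.inverse (1 + s) := by
  obtain ⟨u, hu⟩ := isUnit_one_add_of_nonneg hs
  rw [← hu, Ring.inverse_unit]
  exact CFC.inv_nonneg_of_nonneg u (hu ▸ add_nonneg zero_le_one hs)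

theorem inverse_one_add_antitone {s s' : A} (hs : 0 ≤ s) (h : s ≤ s') :
    Ring.inverse (1 + s') ≤ Ring.inverse (1 + s) := by
  obtain ⟨u, hu⟩ := isUnit_one_add_of_nonneg hs
  obtain ⟨u', hu'⟩ := isUnit_one_add_of_nonneg (hs.trans h)
  rw [← hu, ← hu', Ring.inverse_unit, Ring.inverse_unit]
  refine CStarAlgebra.inv_le_inv (hu ▸ add_nonneg zero_le_one hs) ?_
  rw [hu, hu']
  gcongr

theorem inverse_one_add_le_one {s : A} (hs : 0 ≤ s) : Ring.inverse (1 + s) ≤ 1 := by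
  simpa using inverse_one_add_antitone le_rfl hs

theorem one_sub_inverse_one_add_le {s : A} (hs : 0 ≤ s) : 1 - Ring.inverse (1 + s) ≤ s := by
  have h1 : Ring.inverse (1 + s) * (1 + s) = 1 :=
    Ring.inverse_mul_cancel _ (isUnit_one_add_of_nonneg hs)
  have h2 : (1 + s) * Ring.inverse (1 + s) = 1 :=
    Ring.mul_inverse_cancel _ (isUnit_one_add_of_nonneg hs)
  have h0 := (IsSelfAdjoint.of_nonneg hs).conjugate_nonneg (inverse_one_add_nonneg hs)
  rw [mul_add, mul_one] at h1
  rw [add_mul, one_mul] at h2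
  set r := Ring.inverse (1 + s)
  have h3 : s * r * s = s - (1 - r) := by
    have h4 : s * r = 1 - r := eq_sub_of_add_eq' h2
    have h5 : r * s = 1 - r := eq_sub_of_add_eq' h1
    rw [h4, sub_mul, one_mul, h5]
  rw [h3] at h0
  exact sub_nonneg.1 h0

theorem norm_inverse_one_add_le {s : A} (hs : 0 ≤ s) : ‖Ring.inverse (1 + s)‖ ≤ 1 :=
  (CStarAlgebra.norm_le_one_iff_of_nonneg _ (inverse_one_add_nonneg hs)).2
    (inverse_one_add_le_one hs)

/-- With `r = (1 + s)⁻¹`, the bound is `r (t d⋆d) r ≤ r (1 + s) r = r ≤ 1`: where `d` is large the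
weight `r` is small. -/
theorem norm_mul_inverse_one_add_sq_le {s d : A} (hs : 0 ≤ s) {t : ℝ} (ht : 0 < t)
    (h : t • (star d * d) ≤ s) : ‖d * Ring.inverse (1 + s)‖ ^ 2 ≤ t⁻¹ := by
  have h1 : Ring.inverse (1 + s) * (1 + s) = 1 :=
    Ring.inverse_mul_cancel _ (isUnit_one_add_of_nonneg hs)
  have hr := inverse_one_add_nonneg hs
  have hr1 := inverse_one_add_le_one hs
  set r := Ring.inverse (1 + s)
  have hrs : IsSelfAdjoint r := .of_nonneg hr
  have h2 : r * (t • (star d * d)) * r ≤ r * (1 + s) * r :=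
    conjugate_le_conjugate_of_nonneg (h.trans (le_add_of_nonneg_left zero_le_one)) hr
  rw [h1, one_mul, mul_smul_comm, smul_mul_assoc] at h2
  have h3 : star (d * r) * (d * r) = r * (star d * d) * r := by
    rw [star_mul, hrs.star_eq]
    simp only [mul_assoc]
  rw [sq, ← CStarRing.norm_star_mul_self, ← mul_le_mul_iff_right₀ ht, mul_inv_cancel₀ ht.ne', h3]
  have h4 : t * ‖r * (star d * d) * r‖ = ‖t • (r * (star d * d) * r)‖ := by
    rw [norm_smul, Real.norm_of_nonneg ht.le]
  rw [h4]
  refine (CStarAlgebra.norm_le_one_iff_of_nonneg _ ?_).2 (h2.trans hr1)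
  rw [← h3]
  exact smul_nonneg ht.le (star_mul_self_nonneg _)

theorem mul_self_le_self_of_le_one {w : A} (h0 : 0 ≤ w) (h1 : w ≤ 1) : w * w ≤ w := by
  have h := conjugate_le_conjugate_of_nonneg h1 (CFC.sqrt_nonneg w)
  have hw : CFC.sqrt w * CFC.sqrt w = w := CFC.sqrt_mul_sqrt_self w h0
  have h2 : CFC.sqrt w * w * CFC.sqrt w = w * w :=
    calc CFC.sqrt w * w * CFC.sqrt w
      _ = CFC.sqrt w * (CFC.sqrt w * CFC.sqrt w) * CFC.sqrt w := by rw [hw]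
      _ = (CFC.sqrt w * CFC.sqrt w) * (CFC.sqrt w * CFC.sqrt w) := by simp only [mul_assoc]
      _ = w * w := by rw [hw]
  rwa [mul_one, hw, h2] at h

end Resolvent

/-! ### Completeness of balls in the uniform 2-norm -/

namespace VonNeumannAlgebra

namespace TracialCondExp

section Completeness

open Filter Topology

variable {H : Type u} [NormedAddCommGroup H] [InnerProductSpace ℂ H] [CompleteSpace H]
  {M N : VonNeumannAlgebra H} (E : TracialCondExp M N) (U : N →ₐ[ℂ] ℂ)

theorem mono {x y : M} (h : x ≤ y) : E.toLinearMap x ≤ E.toLinearMap y := by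
  rw [← sub_nonneg, ← map_sub]
  exact E.nonneg _ (sub_nonneg.2 h)

/-- Normality enters here: `1 - T` is the supremum of the increasing family `1 - r k`, so `E`
carries the uniform bound over to it. -/
theorem le_of_isWeakLim_antitone {L : Ultrafilter ℕ} (hL : (L : Filter ℕ) ≤ atTop) {r : ℕ → M}
    (hr : Antitone r) {T : M} (hT : IsWeakLim (L : Filter ℕ) r T) {c : N}
    (h : ∀ k, E.toLinearMap (1 - r k) ≤ c) : E.toLinearMap (1 - T) ≤ c := by
  have hlim : IsWeakLim (L : Filter ℕ) (fun k => 1 - r k) (1 - T) := (IsWeakLim.const 1).sub hT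
  have hlub := E.normal (Set.range fun k => 1 - r k) (1 - T) (Set.range_nonempty _)
    (by
      rintro _ ⟨i, rfl⟩ _ ⟨j, rfl⟩
      exact ⟨_, ⟨max i j, rfl⟩, sub_le_sub_left (hr (le_max_left i j)) _,
        sub_le_sub_left (hr (le_max_right i j)) _⟩)
    (by
      constructor
      · rintro _ ⟨_, ⟨k, rfl⟩, rfl⟩
        exact IsWeakLim.le (IsWeakLim.const _) hlim
          (hL ((eventually_ge_atTop k).mono fun j hj => sub_le_sub_left (hr hj) _))
      · intro B hB
        exact IsWeakLimit.le hlim (IsWeakLimit.const B)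
          (Eventually.of_forall fun k => hB ⟨_, ⟨k, rfl⟩, rfl⟩))
  refine hlub.2 ?_
  rintro _ ⟨_, ⟨k, rfl⟩, rfl⟩
  exact h k

theorem nonneg_character {n : N} (hn : 0 ≤ n) : 0 ≤ U n := by
  obtain ⟨s, rfl⟩ := CStarAlgebra.nonneg_iff_eq_star_mul_self.1 hn
  rw [map_mul, map_star]
  exact star_mul_self_nonneg _

theorem norm_toPreGNS_sq_le {x : M} {c : ℝ} (h : E.toLinearMap (star x * x) ≤ c • 1) :
    ‖(E.functional U).toPreGNS x‖ ^ 2 ≤ c := by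
  have h1 := (E.functional U).preGNS_norm_sq ((E.functional U).toPreGNS x)
  rw [PositiveLinearMap.ofPreGNS_toPreGNS, functional_apply] at h1
  have h2 := nonneg_character U (sub_nonneg.2 h)
  rw [map_sub, ← Complex.coe_smul, map_smul, map_one, ← h1, smul_eq_mul, mul_one,
    ← Complex.ofReal_pow, ← Complex.ofReal_sub] at h2
  exact sub_nonneg.1 (Complex.zero_le_real.1 h2)

theorem norm_toPreGNS_mul_le (a x : M) : ‖(E.functional U).toPreGNS (a * x)‖ ≤
    ‖a‖ * ‖(E.functional U).toPreGNS x‖ := by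
  refine (((E.functional U).leftMulMapPreGNS a).le_opNorm ((E.functional U).toPreGNS x)).trans ?_
  gcongr
  exact LinearMap.mkContinuous_norm_le _ (norm_nonneg _) _

theorem norm_toPreGNS_one : ‖(E.functional U).toPreGNS 1‖ = 1 := by
  have h1 := (E.functional U).preGNS_norm_sq ((E.functional U).toPreGNS 1)
  rw [PositiveLinearMap.ofPreGNS_toPreGNS, functional_apply, star_one, one_mul,
    Ultrafiber.map_one_eq, map_one U] at h1
  have h2 : ‖(E.functional U).toPreGNS 1‖ ^ 2 = 1 := by exact_mod_cast h1
  exact (pow_eq_one_iff_of_nonneg (norm_nonneg _) two_ne_zero).1 h2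

/-- A noncommutative Egorov argument: `r` is the limit of `(1 + s k)⁻¹`, where `s k` sums the `4 ^ n
d n⋆ d n` from `n = K` on. Since `E (s k)` is of order `4⁻¹ ^ K`, `r` is close to 1 in 2-norm. Since
`4 ^ n d n⋆ d n` is eventually a summand, `d n * r` is small in operator norm. -/
theorem exists_weight {d : ℕ → M} (hd : ∀ n, E.toLinearMap (star (d n) * d n) ≤ (16⁻¹ : ℝ) ^ n • 1)
    (K : ℕ) : ∃ r : M, ‖(E.functional U).toPreGNS (1 - r)‖ ≤ 2 * 2⁻¹ ^ K ∧
      ∀ n, K ≤ n → ‖d n * r‖ ≤ 2⁻¹ ^ n := by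
  let s : ℕ → M := fun k => ∑ i ∈ Finset.range k, (4 : ℝ) ^ (K + i) • (star (d (K + i)) * d (K + i))
  have hterm : ∀ i, 0 ≤ (4 : ℝ) ^ (K + i) • (star (d (K + i)) * d (K + i)) := fun i =>
    smul_nonneg (by positivity) (star_mul_self_nonneg _)
  have hs0 : ∀ k, 0 ≤ s k := fun k => Finset.sum_nonneg fun i _ => hterm i
  have hsmono : Monotone s := fun i j hij =>
    Finset.sum_le_sum_of_subset_of_nonneg (Finset.range_mono hij) fun i _ _ => hterm i
  have hEs : ∀ k, E.toLinearMap (s k) ≤ (2 * 4⁻¹ ^ K : ℝ) • 1 := by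
    intro k
    -- The subtracted tail lets the induction close; it is dropped afterwards.
    have h1 : E.toLinearMap (s k) ≤ (2 * 4⁻¹ ^ K - 2 * 4⁻¹ ^ (K + k) : ℝ) • 1 := by
      induction k with
      | zero => simp [s]
      | succ k ih =>
        have h2 : E.toLinearMap (s (k + 1)) = E.toLinearMap (s k) +
            (4 : ℝ) ^ (K + k) • E.toLinearMap (star (d (K + k)) * d (K + k)) := by
          simp only [s, Finset.sum_range_succ, map_add, LinearMap.map_smul_of_tower]
        have h3 : (4 : ℝ) ^ (K + k) • E.toLinearMap (star (d (K + k)) * d (K + k)) ≤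
            ((4⁻¹ : ℝ) ^ (K + k)) • (1 : N) := by
          refine (smul_le_smul_of_nonneg_left (hd (K + k)) (by positivity)).trans_eq ?_
          rw [smul_smul, ← mul_pow]
          norm_num
        rw [h2]
        refine (add_le_add ih h3).trans ?_
        rw [← add_smul]
        refine smul_le_smul_of_nonneg_right ?_ zero_le_one
        rw [← add_assoc, pow_succ]
        have : (0 : ℝ) ≤ 4⁻¹ ^ (K + k) := by positivity
        linarith
    refine h1.trans (smul_le_smul_of_nonneg_right ?_ zero_le_one)
    have : (0 : ℝ) ≤ 4⁻¹ ^ (K + k) := by positivity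
    linarith
  let r : ℕ → M := fun k => Ring.inverse (1 + s k)
  have hr : Antitone r := fun i j hij => inverse_one_add_antitone (hs0 i) (hsmono hij)
  let L : Ultrafilter ℕ := hyperfilter ℕ
  have hL : (L : Filter ℕ) ≤ atTop := by
    rw [← Nat.cofinite_eq_atTop]; exact hyperfilter_le_cofinite
  obtain ⟨T, hT⟩ := exists_isWeakLim L r 1 fun k => norm_inverse_one_add_le (hs0 k)
  have hT0 : 0 ≤ T := (IsWeakLim.const 0).le hT
    (Eventually.of_forall fun k => inverse_one_add_nonneg (hs0 k))
  have hT1 : T ≤ 1 := hT.le (IsWeakLim.const 1)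
    (Eventually.of_forall fun k => inverse_one_add_le_one (hs0 k))
  have hET : E.toLinearMap (1 - T) ≤ (2 * 4⁻¹ ^ K : ℝ) • 1 :=
    E.le_of_isWeakLim_antitone hL hr hT fun k =>
      (E.mono (one_sub_inverse_one_add_le (hs0 k))).trans (hEs k)
  refine ⟨T, ?_, fun n hn => ?_⟩
  -- As `0 ≤ 1 - T ≤ 1`, its square is below it, so the bound on `E (1 - T)` controls the 2-norm.
  · have h1 : star (1 - T) * (1 - T) ≤ 1 - T := by
      rw [(IsSelfAdjoint.one M |>.sub (.of_nonneg hT0)).star_eq]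
      exact mul_self_le_self_of_le_one (sub_nonneg.2 hT1) (sub_le_self _ hT0)
    have h2 := E.norm_toPreGNS_sq_le U ((E.mono h1).trans hET)
    refine abs_le_of_sq_le_sq' (h2.trans ?_) (by positivity) |>.2
    have h3 : ((4 : ℝ)⁻¹) ^ K = (2⁻¹ ^ K) ^ 2 := by
      rw [← pow_mul, mul_comm, pow_mul]; norm_num
    rw [h3]
    nlinarith [sq_nonneg ((2 : ℝ)⁻¹ ^ K)]
  · refine (hT.mul_left (d n)).norm_le (by positivity) (hL ?_)
    filter_upwards [eventually_gt_atTop (n - K)] with k hk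
    have h1 : (4 : ℝ) ^ n • (star (d n) * d n) ≤ s k := by
      have := Finset.single_le_sum
        (f := fun i => (4 : ℝ) ^ (K + i) • (star (d (K + i)) * d (K + i)))
        (fun i _ => hterm i) (Finset.mem_range.2 hk)
      simpa only [Nat.add_sub_cancel' hn] using this
    have h2 := norm_mul_inverse_one_add_sq_le (hs0 k) (by positivity) h1
    refine abs_le_of_sq_le_sq' (h2.trans ?_) (by positivity) |>.2
    rw [← pow_mul, mul_comm, pow_mul, ← inv_pow]; norm_num

/-- Bounded sequences in `M` that are Cauchy in the uniform `2`-norm converge in `M`. -/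
theorem exists_tendsto_of_summable {a : ℕ → M} (ha : ∀ n, ‖a n‖ ≤ 1)
    (hd : ∀ n, E.toLinearMap (star (a (n + 1) - a n) * (a (n + 1) - a n)) ≤ (16⁻¹ : ℝ) ^ n • 1) :
    ∃ y : M, Tendsto (fun n => ‖(E.functional U).toPreGNS (a n - y)‖) atTop (𝓝 0) := by
  let L : Ultrafilter ℕ := hyperfilter ℕ
  have hL : (L : Filter ℕ) ≤ atTop := by
    rw [← Nat.cofinite_eq_atTop]; exact hyperfilter_le_cofinite
  obtain ⟨y, hy⟩ := exists_isWeakLim L a 1 ha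
  have hy1 : ‖y‖ ≤ 1 := hy.norm_le zero_le_one (Eventually.of_forall ha)
  refine ⟨y, squeeze_zero (g := fun K => 6 * 2⁻¹ ^ K) (fun _ => norm_nonneg _) (fun K => ?_) ?_⟩
  · obtain ⟨r, hr, hdr⟩ := E.exists_weight U hd K
    have h1 : ∀ j, ‖(a (K + j) - a K) * r‖ ≤ 2 * 2⁻¹ ^ K - 2 * 2⁻¹ ^ (K + j) := by
      intro j
      induction j with
      | zero => simp
      | succ j ih =>
        have h2 : (a (K + (j + 1)) - a K) * r =
            (a (K + j) - a K) * r + (a (K + j + 1) - a (K + j)) * r := by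
          rw [← add_mul, ← add_assoc]; congr 1; abel
        rw [h2]
        refine (norm_add_le _ _).trans ?_
        have h3 := hdr (K + j) (Nat.le_add_right _ _)
        rw [← add_assoc, pow_succ]
        linarith
    have h2 : ‖(a K - y) * r‖ ≤ 2 * 2⁻¹ ^ K := by
      rw [← norm_neg, ← neg_mul, neg_sub]
      refine ((hy.sub (IsWeakLim.const (a K))).mul_right r).norm_le (by positivity) (hL ?_)
      filter_upwards [eventually_ge_atTop K] with n hn
      obtain ⟨j, rfl⟩ := Nat.exists_eq_add_of_le hn
      have : (0 : ℝ) ≤ 2 * 2⁻¹ ^ (K + j) := by positivity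
      linarith [h1 j]
    -- The first term is small in operator norm by telescoping, the second in 2-norm because `r` is
    -- close to 1. Together they give `2 + 4 = 6` times `2⁻¹ ^ K`.
    have h3 : a K - y = (a K - y) * r * 1 + (a K - y) * (1 - r) := by noncomm_ring
    rw [h3, map_add]
    refine (norm_add_le _ _).trans ?_
    have h4 := E.norm_toPreGNS_mul_le U ((a K - y) * r) 1
    have h5 := E.norm_toPreGNS_mul_le U (a K - y) (1 - r)
    have h6 : ‖a K - y‖ ≤ 2 := (norm_sub_le _ _).trans (by linarith [ha K])
    rw [norm_toPreGNS_one, mul_one ‖(a K - y) * r‖] at h4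
    have h7 : ‖a K - y‖ * ‖(E.functional U).toPreGNS (1 - r)‖ ≤ 2 * (2 * 2⁻¹ ^ K) := by gcongr
    linarith
  · simpa using (tendsto_pow_atTop_nhds_zero_of_lt_one (r := (2⁻¹ : ℝ)) (by norm_num)
      (by norm_num)).const_mul 6

end Completeness

end TracialCondExp

end VonNeumannAlgebra

/-- The resolvent of a self-adjoint element at `-i`. -/
theorem IsSelfAdjoint.exists_resolvent {A : Type*} [CStarAlgebra A] [PartialOrder A]
    [StarOrderedRing A] {b : A} (hb : IsSelfAdjoint b) :
    ∃ a : A, a * (b + algebraMap ℂ A Complex.I) = 1 ∧ (b + algebraMap ℂ A Complex.I) * a = 1 ∧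
      ‖a‖ ≤ 1 ∧ a * star a * (1 + b * b) = 1 := by
  have hbb : 0 ≤ b * b := by
    have := star_mul_self_nonneg b
    rwa [hb.star_eq] at this
  have h1 : Ring.inverse (1 + b * b) * (1 + b * b) = 1 :=
    Ring.inverse_mul_cancel _ (isUnit_one_add_of_nonneg hbb)
  have h2 : (1 + b * b) * Ring.inverse (1 + b * b) = 1 :=
    Ring.mul_inverse_cancel _ (isUnit_one_add_of_nonneg hbb)
  have hr := inverse_one_add_nonneg hbb
  have hrn := norm_inverse_one_add_le hbb
  have hcomm : Commute b (Ring.inverse (1 + b * b)) := by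
    have hc : Commute b (1 + b * b) :=
      (Commute.one_right b).add_right ((Commute.refl b).mul_right (.refl b))
    obtain ⟨u, hu⟩ := isUnit_one_add_of_nonneg hbb
    rw [← hu] at hc ⊢
    rw [Ring.inverse_unit]
    exact hc.units_inv_right
  set r := Ring.inverse (1 + b * b)
  set j := algebraMap ℂ A Complex.I with hj
  have hjj : j * j = -1 := by rw [hj, ← map_mul, Complex.I_mul_I, map_neg, map_one]
  have hjc : ∀ x, j * x = x * j := Algebra.commutes _
  have hjs : star j = -j := by
    rw [hj, ← algebraMap_star_comm, ← map_neg]; simp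
  have hprod : (b - j) * (b + j) = 1 + b * b := by
    rw [sub_mul, mul_add, mul_add, hjj, hjc b]; abel
  have hprod' : (b + j) * (b - j) = 1 + b * b := by
    rw [add_mul, mul_sub, mul_sub, hjj, hjc b]; abel
  have hcj : Commute (b - j) r := hcomm.sub_left (hjc r)
  have hcj' : Commute (b + j) r := hcomm.add_left (hjc r)
  have hstar : star ((b - j) * r) = r * (b + j) := by
    rw [star_mul, star_sub, hb.star_eq, hjs, sub_neg_eq_add, (IsSelfAdjoint.of_nonneg hr).star_eq]
  refine ⟨(b - j) * r, ?_, ?_, ?_, ?_⟩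
  · rw [hcj.eq, mul_assoc, hprod, h1]
  · rw [← mul_assoc, hprod', h2]
  · have h3 : star ((b - j) * r) * ((b - j) * r) = r := by
      rw [hstar, mul_assoc, ← mul_assoc (b + j), hprod', h2, mul_one]
    have h4 : ‖(b - j) * r‖ * ‖(b - j) * r‖ ≤ 1 := by
      rw [← CStarRing.norm_star_mul_self, h3]; exact hrn
    nlinarith [norm_nonneg ((b - j) * r)]
  · rw [hstar, hcj.eq, ← hcj'.eq, mul_assoc r, ← mul_assoc (b - j), hprod, h2, mul_one, h1]

/-! ### The GNS representation of the trace -/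

namespace VonNeumannAlgebra

namespace TracialCondExp

section Representation

open Filter Topology
open scoped InnerProductSpace

variable {H : Type u} [NormedAddCommGroup H] [InnerProductSpace ℂ H] [CompleteSpace H]
  {M N : VonNeumannAlgebra H} (E : TracialCondExp M N) (U : N →ₐ[ℂ] ℂ)

/-- The Hilbert space of the trace `𝒰 ∘ E`. -/
abbrev GNS : Type u := (E.functional U).GNS

/-- The vector of `x` in the Hilbert space of the trace. -/
noncomputable def vec : M →ₗ[ℂ] E.GNS U :=
  UniformSpace.Completion.toComplₗᵢ.toLinearMap ∘ₗ (E.functional U).toPreGNS.toLinearMap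

theorem norm_vec (x : M) : ‖E.vec U x‖ = ‖(E.functional U).toPreGNS x‖ :=
  UniformSpace.Completion.norm_coe _

theorem inner_vec (x y : M) : ⟪E.vec U x, E.vec U y⟫_ℂ = E.functional U (star x * y) :=
  UniformSpace.Completion.inner_coe _ _

theorem denseRange_vec : DenseRange (E.vec U) :=
  UniformSpace.Completion.denseRange_coe.comp (E.functional U).toPreGNS.surjective.denseRange
    (UniformSpace.Completion.continuous_coe _)

theorem norm_vec_star (x : M) : ‖E.vec U (star x)‖ = ‖E.vec U x‖ := by
  have h : ∀ y : M, ((‖E.vec U y‖ : ℂ)) ^ 2 = E.functional U (star y * y) := fun y => by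
    rw [← inner_vec, inner_self_eq_norm_sq_to_K]; rfl
  have h1 := h (star x)
  rw [star_star, E.functional_comm, ← h x] at h1
  exact (pow_left_inj₀ (norm_nonneg _) (norm_nonneg _) two_ne_zero).1 (by exact_mod_cast h1)

theorem vec_eq_zero_iff {x : M} : E.vec U x = 0 ↔ x ∈ E.ultrafiberIdeal U := by
  rw [← norm_eq_zero, norm_vec, ← functional_star_mul_self_eq_zero_iff]
  rfl

/-- The representation of `M` by left multiplication on the Hilbert space of the trace. -/
noncomputable def rep : M →⋆ₐ[ℂ] (E.GNS U →L[ℂ] E.GNS U) := (E.functional U).gnsStarAlgHom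

theorem rep_vec (a x : M) : E.rep U a (E.vec U x) = E.vec U (a * x) :=
  (E.functional U).gnsNonUnitalStarAlgHom_apply_coe

theorem norm_vec_mul_right_le (x b : M) : ‖E.vec U (x * b)‖ ≤ ‖b‖ * ‖E.vec U x‖ := by
  rw [← norm_vec_star, star_mul, ← norm_vec_star E U x, ← norm_star b, norm_vec, norm_vec]
  exact E.norm_toPreGNS_mul_le U _ _

/-- Right multiplication on the Hilbert space of the trace. -/
noncomputable def rightMul (b : M) : E.GNS U →L[ℂ] E.GNS U :=
  ((((E.functional U).toPreGNS.toLinearMap ∘ₗ LinearMap.mulRight ℂ b) ∘ₗ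
    (E.functional U).ofPreGNS.toLinearMap).mkContinuous ‖b‖ fun x => by
      have := E.norm_vec_mul_right_le U ((E.functional U).ofPreGNS x) b
      rwa [norm_vec, norm_vec] at this).completion

theorem rightMul_vec (b x : M) : E.rightMul U b (E.vec U x) = E.vec U (x * b) :=
  ContinuousLinearMap.completion_apply_coe _ _

theorem rep_mul_rightMul (a b : M) : E.rep U a * E.rightMul U b = E.rightMul U b * E.rep U a := by
  refine ContinuousLinearMap.ext fun ξ => ?_
  refine (E.denseRange_vec U).induction_on ξ (isClosed_eq (by fun_prop) (by fun_prop)) fun x => ?_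
  simp only [mul_apply_eq_comp, rep_vec, rightMul_vec, mul_assoc]

/-- The commutant of the representation on the Hilbert space of the trace. -/
noncomputable def repCommutant : VonNeumannAlgebra (E.GNS U) where
  toStarSubalgebra := StarSubalgebra.centralizer ℂ (Set.range (E.rep U))
  centralizer_centralizer' := by simp

theorem mem_repCommutant_iff {X : E.GNS U →L[ℂ] E.GNS U} :
    X ∈ E.repCommutant U ↔ ∀ a : M, E.rep U a * X = X * E.rep U a := by
  change X ∈ StarSubalgebra.centralizer ℂ (Set.range (E.rep U)) ↔ _
  rw [StarSubalgebra.mem_centralizer_iff]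
  constructor
  · exact fun h a => (h _ ⟨a, rfl⟩).1
  · rintro h _ ⟨a, rfl⟩
    exact ⟨h a, by rw [← map_star, h]⟩

theorem rightMul_mem (b : M) : E.rightMul U b ∈ E.repCommutant U :=
  (E.mem_repCommutant_iff U).2 fun a => E.rep_mul_rightMul U a b

/-- The von Neumann algebra generated by the representation. -/
noncomputable def repClosure : VonNeumannAlgebra (E.GNS U) := (E.repCommutant U).commutant

theorem rep_mem (a : M) : E.rep U a ∈ E.repClosure U :=
  mem_commutant_iff.2 fun _ hX => ((E.mem_repCommutant_iff U).1 hX a).symm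

/-- The representation, as a map into the von Neumann algebra it generates. -/
noncomputable def repHom : M →⋆ₐ[ℂ] E.repClosure U where
  toFun a := ⟨E.rep U a, E.rep_mem U a⟩
  map_one' := Subtype.ext (map_one _)
  map_mul' _ _ := Subtype.ext (map_mul _ _ _)
  map_zero' := Subtype.ext (map_zero _)
  map_add' _ _ := Subtype.ext (map_add _ _ _)
  commutes' c := Subtype.ext ((E.rep U).toAlgHom.commutes c)
  map_star' _ := Subtype.ext (map_star _ _)

variable {E U}

/-- The value of an operator at the vector of `1`. -/
noncomputable def orbit (X : E.repClosure U) : E.GNS U :=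
  (X : E.GNS U →L[ℂ] E.GNS U) (E.vec U 1)

/-- Right multiplications lie in the commutant, so `X` commutes with them. Hence the vector of `1`
is separating. -/
theorem apply_vec (X : E.repClosure U) (b : M) :
    (X : E.GNS U →L[ℂ] E.GNS U) (E.vec U b) = E.rightMul U b (orbit X) := by
  have h := congrArg (fun T : E.GNS U →L[ℂ] E.GNS U => T (E.vec U 1))
    (mem_commutant_iff.1 X.2 _ (E.rightMul_mem U b))
  have h1 : E.rightMul U b (orbit X) = (X : E.GNS U →L[ℂ] E.GNS U) (E.rightMul U b (E.vec U 1)) := h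
  rw [h1, rightMul_vec, one_mul]

theorem orbit_injective : Function.Injective (orbit (E := E) (U := U)) := by
  intro X Y h
  refine Subtype.ext (ContinuousLinearMap.ext fun ξ => ?_)
  refine (E.denseRange_vec U).induction_on ξ (isClosed_eq (by fun_prop) (by fun_prop)) fun x => ?_
  rw [apply_vec, apply_vec, h]

theorem orbit_repHom (a : M) : orbit (E.repHom U a) = E.vec U a := by
  change E.rep U a (E.vec U 1) = _
  rw [rep_vec, mul_one]

theorem orbit_sub (X Y : E.repClosure U) : orbit (X - Y) = orbit X - orbit Y := rfl

theorem norm_orbit_mul_le (X Y : E.repClosure U) : ‖orbit (X * Y)‖ ≤ ‖X‖ * ‖orbit Y‖ :=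
  (X : E.GNS U →L[ℂ] E.GNS U).le_opNorm _

/-- Traciality extends to the bicommutant: pairing `X⋆1` with the vector of `b` equals pairing the
vector of `b⋆` with `X1`, up to the order of the inner product, and `b`, `b⋆` have equal 2-norm. -/
theorem norm_orbit_star_le (X : E.repClosure U) : ‖orbit (star X)‖ ≤ ‖orbit X‖ := by
  have h1 : ∀ (b : M) (ξ : E.GNS U), ⟪E.rightMul U b ξ, E.vec U 1⟫_ℂ = ⟪ξ, E.vec U (star b)⟫_ℂ := by
    intro b ξ
    refine (E.denseRange_vec U).induction_on ξ (isClosed_eq (by fun_prop) (by fun_prop)) fun x => ?_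
    rw [rightMul_vec, inner_vec, inner_vec, mul_one, star_mul, E.functional_comm]
  have h2 : ∀ ξ : E.GNS U, ‖⟪ξ, orbit (star X)⟫_ℂ‖ ≤ ‖ξ‖ * ‖orbit X‖ := by
    intro ξ
    refine (E.denseRange_vec U).induction_on ξ (isClosed_le (by fun_prop) (by fun_prop)) fun b => ?_
    have h3 : ⟪E.vec U b, orbit (star X)⟫_ℂ = ⟪orbit X, E.vec U (star b)⟫_ℂ := by
      rw [← h1, ← apply_vec]
      exact ContinuousLinearMap.adjoint_inner_right _ _ _
    rw [h3, ← norm_vec_star E U b, mul_comm]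
    exact norm_inner_le_norm _ _
  have h4 := h2 (orbit (star X))
  rw [inner_self_eq_norm_sq_to_K, norm_pow, RCLike.norm_ofReal, abs_norm, sq] at h4
  rcases (norm_nonneg (orbit (star X))).eq_or_lt with h0 | h0
  · rw [← h0]; positivity
  · exact le_of_mul_le_mul_left h4 h0

theorem norm_orbit_mul_le' (X Y : E.repClosure U) : ‖orbit (X * Y)‖ ≤ ‖orbit X‖ * ‖Y‖ := by
  have h1 := norm_orbit_star_le (star (X * Y))
  rw [star_star, star_mul] at h1
  refine h1.trans ((norm_orbit_mul_le _ _).trans ?_)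
  rw [norm_star, mul_comm]
  gcongr
  exact norm_orbit_star_le X

/-- Any approximant `x` may be replaced by its self-adjoint part, because the adjoint does not
increase the 2-norm of `S - x`. -/
theorem exists_selfAdjoint_approx (S : E.repClosure U) (hS : IsSelfAdjoint S) {ε : ℝ} (hε : 0 < ε) :
    ∃ c : M, IsSelfAdjoint c ∧ ‖orbit S - E.vec U c‖ ≤ ε := by
  obtain ⟨x, hx⟩ := (E.denseRange_vec U).exists_dist_lt (orbit S) hε
  rw [dist_eq_norm, ← orbit_repHom, ← orbit_sub] at hx
  have hx' : ‖orbit (S - E.repHom U (star x))‖ ≤ ε := by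
    have := norm_orbit_star_le (S - E.repHom U x)
    rw [star_sub, hS.star_eq, ← map_star] at this
    exact this.trans hx.le
  refine ⟨(2⁻¹ : ℂ) • (x + star x), ?_, ?_⟩
  · rw [isSelfAdjoint_iff, star_smul, star_add, star_star, add_comm]
    simp
  · have h1 : orbit S - E.vec U ((2⁻¹ : ℂ) • (x + star x)) =
        (2⁻¹ : ℂ) • (orbit (S - E.repHom U x) + orbit (S - E.repHom U (star x))) := by
      rw [orbit_sub, orbit_sub, orbit_repHom, orbit_repHom, map_smul, map_add]
      module
    rw [h1, norm_smul]
    have h2 := norm_add_le (orbit (S - E.repHom U x)) (orbit (S - E.repHom U (star x)))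
    have h3 : ‖(2⁻¹ : ℂ)‖ = 2⁻¹ := by simp
    rw [h3]
    linarith

end Representation

end TracialCondExp

end VonNeumannAlgebra

/-! ### The image of `M` is its own bicommutant -/

theorem map_sub_eq_mul_of_resolvent {A B : Type*} [Ring A] [Algebra ℂ A] [Ring B] [Algebra ℂ B]
    (f : A →ₐ[ℂ] B) {a b : A} {c : ℂ} (ha : a * (b + algebraMap ℂ A c) = 1) {S Y : B}
    (hY : (S + algebraMap ℂ B c) * Y = 1) : f a - Y = f a * ((S - f b) * Y) := by
  have h1 : S - f b = (S + algebraMap ℂ B c) - f (b + algebraMap ℂ A c) := by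
    rw [map_add, AlgHom.commutes]; abel
  rw [h1, sub_mul, hY, mul_sub, mul_one, ← mul_assoc, ← map_mul, ha, map_one, one_mul]

/-- Every positive element is expressed by a resolvent of a self-adjoint element. -/
theorem exists_smul_mul_star_eq_one_add {A : Type*} [CStarAlgebra A] [PartialOrder A]
    [StarOrderedRing A] {T : A} (hT : 0 ≤ T) :
    ∃ (S : A) (t : ℝ), IsSelfAdjoint S ∧
      ∀ Y : A, Y * star Y * (1 + S * S) = 1 → t • (Y * star Y) = 1 + T := by
  have hq1 : Ring.inverse (1 + T) * (1 + T) = 1 :=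
    Ring.inverse_mul_cancel _ (isUnit_one_add_of_nonneg hT)
  set t : ℝ := 1 + ‖T‖ with ht
  have ht0 : 0 < t := by positivity
  have hle : t⁻¹ • (1 : A) ≤ Ring.inverse (1 + T) := by
    have h1 : T ≤ ‖T‖ • (1 : A) := by
      rw [← Algebra.algebraMap_eq_smul_one]
      exact (IsSelfAdjoint.of_nonneg hT).le_algebraMap_norm_self
    have h2 := inverse_one_add_antitone hT h1
    have h3 : (1 : A) + ‖T‖ • 1 = t • 1 := by rw [ht, add_smul, one_smul]
    have h4 : Ring.inverse (t • (1 : A)) = t⁻¹ • 1 := by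
      have h5 := Ring.inverse_mul_cancel _ (isUnit_one_add_of_nonneg (hT.trans h1))
      rw [h3, mul_smul_comm, mul_one] at h5
      rw [eq_inv_smul_iff₀ ht0.ne', h5]
    rwa [h3, h4] at h2
  set q := Ring.inverse (1 + T)
  have hP : 0 ≤ t • q - 1 := by
    have := smul_le_smul_of_nonneg_left hle ht0.le
    rw [smul_smul, mul_inv_cancel₀ ht0.ne', one_smul] at this
    exact sub_nonneg.2 this
  -- Chosen so that `1 + S²` is `t (1 + T)⁻¹`. The value `t = 1 + ‖T‖` makes the quantity under the
  -- root positive.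
  refine ⟨CFC.sqrt (t • q - 1), t, .of_nonneg (CFC.sqrt_nonneg _), fun Y hY => ?_⟩
  rw [CFC.sqrt_mul_sqrt_self _ hP, add_sub_cancel] at hY
  have := congrArg (· * (1 + T)) hY
  simpa only [mul_smul_comm, smul_mul_assoc, mul_assoc, hq1, mul_one, one_mul] using this

namespace VonNeumannAlgebra

namespace TracialCondExp

section Bicommutant

open Filter Topology

variable {H : Type u} [NormedAddCommGroup H] [InnerProductSpace ℂ H] [CompleteSpace H]
  {M N : VonNeumannAlgebra H} {E : TracialCondExp M N} {U : N →ₐ[ℂ] ℂ}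

/-- With `c = E(d⋆d)`, the cutoff is `p = k (1 + c/δ)⁻¹`, normalized by `k = 1 + 𝒰(c)/δ ≤ 2` so that
`𝒰 p = 1`. As `N` is central, `E((pd)⋆(pd)) = p c p`, which is at most `k² δ ≤ 4δ`. -/
theorem exists_cutoff (hN : N ≤ M.center) (d : M) {δ : ℝ} (hδ : 0 < δ)
    (hd : ‖E.vec U d‖ ^ 2 ≤ δ) :
    ∃ p : N, IsSelfAdjoint p ∧ U p = 1 ∧
      E.toLinearMap (star (inclusion E.le p * d) * (inclusion E.le p * d)) ≤ (4 * δ) • 1 := by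
  have hcomm : ∀ (n : N) (x : M), inclusion E.le n * x = x * inclusion E.le n := fun n x =>
    (Semigroup.mem_center_iff.1 (coe_mem_center_iff.1 (hN n.2)) x).symm
  set c := E.toLinearMap (star d * d) with hc
  have hc0 : 0 ≤ c := E.nonneg _ (star_mul_self_nonneg d)
  have hUc : U c = ((‖E.vec U d‖ ^ 2 : ℝ) : ℂ) := by
    have h1 := (E.functional U).preGNS_norm_sq ((E.functional U).toPreGNS d)
    rw [PositiveLinearMap.ofPreGNS_toPreGNS, functional_apply] at h1
    rw [norm_vec, hc, ← h1, Complex.ofReal_pow]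
  set t := ‖E.vec U d‖ ^ 2 with ht
  have ht0 : 0 ≤ t := by positivity
  set s : N := δ⁻¹ • c with hs
  have hs0 : 0 ≤ s := smul_nonneg (by positivity) hc0
  have hq1 : Ring.inverse (1 + s) * (1 + s) = 1 :=
    Ring.inverse_mul_cancel _ (isUnit_one_add_of_nonneg hs0)
  have hq0 := inverse_one_add_nonneg hs0
  have hqle := inverse_one_add_le_one hs0
  set q := Ring.inverse (1 + s)
  have hqs : q * s * q ≤ 1 := by
    have h1 : q * s * q ≤ q * (1 + s) * q :=
      conjugate_le_conjugate_of_nonneg (le_add_of_nonneg_left zero_le_one) hq0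
    rw [hq1, one_mul] at h1
    exact h1.trans hqle
  have hUs : U (1 + s) = ((1 + δ⁻¹ * t : ℝ) : ℂ) := by
    rw [map_add, map_one, hs, ← Complex.coe_smul, map_smul, hUc]
    push_cast
    rfl
  have hk : (1 : ℝ) + δ⁻¹ * t ≤ 2 := by
    have : δ⁻¹ * t ≤ 1 := by rw [inv_mul_le_one₀ hδ]; exact hd
    linarith
  set k : ℝ := 1 + δ⁻¹ * t
  have hk0 : 0 ≤ k := by positivity
  have hp : IsSelfAdjoint (k • q) := .smul (.all k) (.of_nonneg hq0)
  refine ⟨k • q, hp, ?_, ?_⟩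
  · have h1 := congrArg U hq1
    rw [map_mul, map_one, hUs] at h1
    rw [← Complex.coe_smul, map_smul, smul_eq_mul, mul_comm, h1]
  · have h1 : star (inclusion E.le (k • q) * d) * (inclusion E.le (k • q) * d) =
        inclusion E.le (k • q) * (star d * d) * inclusion E.le (k • q) := by
      rw [star_mul, ← map_star, hp.star_eq, hcomm _ d]
      rw [← hcomm, mul_assoc, mul_assoc, mul_assoc]
    have h2 : k • q * c * (k • q) = (k ^ 2 * δ) • (q * s * q) := by
      simp only [hs, mul_smul_comm, smul_mul_assoc, smul_smul]
      congr 1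
      field_simp
    rw [h1, E.bimodule, h2]
    refine (smul_le_smul_of_nonneg_left hqs (by positivity)).trans
      (smul_le_smul_of_nonneg_right ?_ zero_le_one)
    gcongr
    nlinarith

theorem vec_mul_sub_eq_zero {p : N} (hp : U p = 1) (d : M) :
    E.vec U (inclusion E.le p * d) = E.vec U d := by
  rw [← sub_eq_zero, ← map_sub, vec_eq_zero_iff]
  have h1 : inclusion E.le p * d - d = inclusion E.le (p - 1) * d := by
    rw [map_sub, map_one, sub_mul, one_mul]
  rw [h1]
  refine (E.ultrafiberIdeal U).mul_mem_right d (Ultrafiber.inclusion_mem_ultrafiberIdeal E U ?_)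
  rw [map_sub, hp, map_one, sub_self]

/-- The increments of a fast 2-norm approximation are multiplied by cutoffs. The vectors stay the
same, while the increments become small uniformly over `N`. Centrality of the cutoffs keeps the sums
self-adjoint. -/
theorem exists_selfAdjoint_seq (hN : N ≤ M.center) (S : E.repClosure U) (hS : IsSelfAdjoint S) :
    ∃ b : ℕ → M, (∀ n, IsSelfAdjoint (b n)) ∧
      Tendsto (fun n => ‖orbit (S - E.repHom U (b n))‖) atTop (𝓝 0) ∧
      ∀ n, E.toLinearMap (star (b (n + 1) - b n) * (b (n + 1) - b n)) ≤ (16⁻¹ : ℝ) ^ n • 1 := by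
  -- This rate makes the squared increments at most `4⁻¹ * 16⁻¹ ^ n`, and the factor 4 lost in the
  -- cutoff leaves `16⁻¹ ^ n`.
  have hε : ∀ n : ℕ, (0 : ℝ) < 4⁻¹ * 4⁻¹ ^ n := fun n => by positivity
  choose c hc hcS using fun n => exists_selfAdjoint_approx S hS (hε n)
  have hd : ∀ n, ‖E.vec U (c (n + 1) - c n)‖ ^ 2 ≤ 4⁻¹ * 16⁻¹ ^ n := by
    intro n
    have h1 : E.vec U (c (n + 1) - c n) =
        (orbit S - E.vec U (c n)) - (orbit S - E.vec U (c (n + 1))) := by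
      rw [map_sub]; abel
    have h2 : ‖E.vec U (c (n + 1) - c n)‖ ≤ 2⁻¹ * 4⁻¹ ^ n := by
      rw [h1]
      refine (norm_sub_le _ _).trans ?_
      have h3 := hcS n
      have h4 := hcS (n + 1)
      rw [pow_succ] at h4
      have : (0 : ℝ) ≤ 4⁻¹ ^ n := by positivity
      linarith
    calc ‖E.vec U (c (n + 1) - c n)‖ ^ 2 ≤ (2⁻¹ * 4⁻¹ ^ n) ^ 2 := by gcongr
      _ = 4⁻¹ * 16⁻¹ ^ n := by
        rw [mul_pow, ← pow_mul, mul_comm n, pow_mul]; norm_num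
  choose p hp hUp hEp using fun n => exists_cutoff hN (c (n + 1) - c n)
    (by positivity : (0 : ℝ) < 4⁻¹ * 16⁻¹ ^ n) (hd n)
  let b : ℕ → M := fun n =>
    c 0 + ∑ i ∈ Finset.range n, inclusion E.le (p i) * (c (i + 1) - c i)
  have hb : ∀ n, b (n + 1) - b n = inclusion E.le (p n) * (c (n + 1) - c n) := fun n => by
    simp only [b, Finset.sum_range_succ]; abel
  have hvec : ∀ n, E.vec U (b n) = E.vec U (c n) := by
    intro n
    induction n with
    | zero => simp [b]
    | succ n ih =>
      rw [← sub_add_cancel (b (n + 1)) (b n), hb, map_add, vec_mul_sub_eq_zero (hUp n), ih,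
        ← map_add, sub_add_cancel]
  refine ⟨b, fun n => ?_, ?_, fun n => ?_⟩
  · refine (hc 0).add (isSelfAdjoint_sum _ fun i _ => ?_)
    rw [isSelfAdjoint_iff, star_mul, ← map_star, (hp i).star_eq, star_sub, (hc i).star_eq,
      (hc (i + 1)).star_eq]
    exact Semigroup.mem_center_iff.1 (coe_mem_center_iff.1 (hN (p i).2)) _
  · refine squeeze_zero (fun _ => norm_nonneg _) (fun n => ?_)
      (g := fun n => 4⁻¹ * (4⁻¹ : ℝ) ^ n) ?_
    · rw [orbit_sub, orbit_repHom, hvec]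
      exact hcS n
    · simpa using (tendsto_pow_atTop_nhds_zero_of_lt_one (r := (4⁻¹ : ℝ)) (by norm_num)
        (by norm_num)).const_mul 4⁻¹
  · rw [hb]
    refine (hEp n).trans_eq ?_
    rw [← mul_assoc]; norm_num

/-- The left contraction drops out by operator order. Traciality moves the right one to the left of
an adjoint, where it drops out too. -/
theorem apply_conjugate_le {a a' D : M} (ha : ‖a‖ ≤ 1) (ha' : ‖a'‖ ≤ 1) {c : N}
    (h : E.toLinearMap (star D * D) ≤ c) :
    E.toLinearMap (star (a' * D * a) * (a' * D * a)) ≤ c := by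
  have key : ∀ x : M, ‖x‖ ≤ 1 → star x * x ≤ 1 := fun x hx => by
    refine CStarAlgebra.norm_le_one_iff_of_nonneg _ (star_mul_self_nonneg x) |>.1 ?_
    rw [CStarRing.norm_star_mul_self]
    exact mul_le_one₀ hx (norm_nonneg x) hx
  have h1 : star (a' * D * a) * (a' * D * a) ≤ star (D * a) * (D * a) := by
    have h := star_left_conjugate_le_conjugate (key a' ha') (D * a)
    simpa only [star_mul, mul_assoc, one_mul, mul_one] using h
  have h2 : star (star (D * a)) * star (D * a) ≤ star (star D) * star D := by
    have h := star_left_conjugate_le_conjugate (key (star a) ((norm_star a).trans_le ha)) (star D)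
    simpa only [star_mul, star_star, mul_assoc, one_mul, mul_one] using h
  have h3 := E.mono h1
  have h4 := E.mono h2
  rw [star_star, star_star, E.tracial, E.tracial D] at h4
  exact h3.trans (h4.trans h)

/-- Resolvents of self-adjoint elements of the generated von Neumann algebra are in the range of
the representation. -/
theorem exists_repHom_eq_resolvent (hN : N ≤ M.center) (S Y : E.repClosure U)
    (hS : IsSelfAdjoint S) (hY1 : ‖Y‖ ≤ 1)
    (hSY : (S + algebraMap ℂ _ Complex.I) * Y = 1) : ∃ y : M, E.repHom U y = Y := by
  obtain ⟨b, hb, hbS, hbE⟩ := exists_selfAdjoint_seq hN S hS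
  choose a ha1 ha2 han _ using fun n => (hb n).exists_resolvent
  have hdiff : ∀ n, a (n + 1) - a n = -(a (n + 1) * (b (n + 1) - b n) * a n) := by
    intro n
    have h1 : b (n + 1) - b n = (b (n + 1) + algebraMap ℂ M Complex.I) -
      (b n + algebraMap ℂ M Complex.I) := by abel
    rw [h1, mul_sub, sub_mul, ha1, mul_assoc, ha2]
    noncomm_ring
  -- By the resolvent identity the `a n` inherit the uniform 2-norm increments of the `b n`, and
  -- unlike those they are contractions.
  obtain ⟨y, hy⟩ := E.exists_tendsto_of_summable U han fun n => by
    rw [hdiff, star_neg, neg_mul_neg]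
    exact apply_conjugate_le (han n) (han (n + 1)) (hbE n)
  refine ⟨y, orbit_injective ?_⟩
  have hlim : Tendsto (fun n => ‖orbit (E.repHom U (a n) - Y)‖) atTop (𝓝 0) := by
    refine squeeze_zero (fun _ => norm_nonneg _) (fun n => ?_) hbS
    have h1 := map_sub_eq_mul_of_resolvent (E.repHom U).toAlgHom (ha1 n) hSY
    change E.repHom U (a n) - Y = E.repHom U (a n) * ((S - E.repHom U (b n)) * Y) at h1
    rw [h1]
    refine (norm_orbit_mul_le _ _).trans ?_
    have h3 : ‖E.repHom U (a n)‖ ≤ 1 :=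
      (NonUnitalStarAlgHom.norm_apply_le (E.repHom U) (a n)).trans (han n)
    have h4 := norm_orbit_mul_le' (S - E.repHom U (b n)) Y
    have h5 : ‖orbit (S - E.repHom U (b n))‖ * ‖Y‖ ≤ ‖orbit (S - E.repHom U (b n))‖ :=
      mul_le_of_le_one_right (norm_nonneg _) hY1
    exact (mul_le_of_le_one_left (norm_nonneg _) h3).trans (h4.trans h5)
  rw [← sub_eq_zero, ← orbit_sub, ← norm_le_zero_iff]
  have hsum : Tendsto (fun n => ‖E.vec U (a n - y)‖ + ‖orbit (E.repHom U (a n) - Y)‖) atTop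
      (𝓝 0) := by
    simpa only [norm_vec, add_zero] using hy.add hlim
  refine ge_of_tendsto hsum (Eventually.of_forall fun n => ?_)
  have h1 : orbit (E.repHom U y - Y) =
      orbit (E.repHom U (a n) - Y) - E.vec U (a n - y) := by
    rw [orbit_sub, orbit_sub, map_sub, orbit_repHom, orbit_repHom]; abel
  rw [h1, add_comm]
  exact norm_sub_le _ _

theorem exists_repHom_eq_of_nonneg (hN : N ≤ M.center) (T : E.repClosure U) (hT : 0 ≤ T) :
    ∃ x : M, E.repHom U x = T := by
  obtain ⟨S, t, hS, hSt⟩ := exists_smul_mul_star_eq_one_add hT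
  obtain ⟨Y, -, hY1, hYn, hYY⟩ := hS.exists_resolvent
  obtain ⟨y, hy⟩ := exists_repHom_eq_resolvent hN S Y hS hYn hY1
  refine ⟨(t : ℂ) • (y * star y) - 1, ?_⟩
  rw [map_sub, map_smul, map_mul, map_star, hy, map_one, Complex.coe_smul, hSt Y hYY,
    add_sub_cancel_left]

theorem repHom_surjective (hN : N ≤ M.center) : Function.Surjective (E.repHom U) := by
  intro X
  have h : (⊤ : Submodule ℂ (E.repClosure U)) ≤
      LinearMap.range (E.repHom U).toAlgHom.toLinearMap := by
    rw [← CStarAlgebra.span_nonneg, Submodule.span_le]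
    exact fun T hT => exists_repHom_eq_of_nonneg hN T hT
  exact h trivial

variable (E U)

/-- The ultrafiber is ⋆-isomorphic to the von Neumann algebra generated by the representation on
the Hilbert space of the trace. -/
noncomputable def Ultrafiber.equivRepClosure (hN : N ≤ M.center) :
    E.Ultrafiber U ≃⋆ₐ[ℂ] E.repClosure U :=
  have hker : ∀ x ∈ E.ultrafiberIdeal U, E.repHom U x = 0 := fun x hx => orbit_injective (by
    rw [orbit_repHom, (E.vec_eq_zero_iff U).2 hx]; rfl)
  let f : E.Ultrafiber U →⋆ₐ[ℂ] E.repClosure U :=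
    { Ideal.Quotient.liftₐ (E.ultrafiberIdeal U) (E.repHom U).toAlgHom hker with
      map_star' := fun a => by
        obtain ⟨x, rfl⟩ := Ultrafiber.mk_surjective E U a
        exact map_star (E.repHom U) x }
  have hf : ∀ x, f (Ultrafiber.mk E U x) = E.repHom U x := fun _ => rfl
  StarAlgEquiv.ofBijective f
    ⟨(injective_iff_map_eq_zero f).2 fun a ha => by
      obtain ⟨x, rfl⟩ := Ultrafiber.mk_surjective E U a
      rw [Ultrafiber.mk_eq_zero_iff, ← vec_eq_zero_iff, ← orbit_repHom, ← hf, ha]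
      rfl, fun X => by
      obtain ⟨x, rfl⟩ := repHom_surjective hN X
      exact ⟨_, hf x⟩⟩

end Bicommutant

end TracialCondExp

end VonNeumannAlgebra

theorem mainTheorem7 {H : Type u} [NormedAddCommGroup H] [InnerProductSpace ℂ H] [CompleteSpace H]
    (M N : VonNeumannAlgebra H) (hM : M.IsFinite) (hN : N ≤ M.center)
    (E : VonNeumannAlgebra.TracialCondExp M N) (U : N →ₐ[ℂ] ℂ) :
    Set.center (E.Ultrafiber U) =
        VonNeumannAlgebra.TracialCondExp.Ultrafiber.mk E U '' Set.center M ∧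
    (∃ φ : (E.restrictCenter hN).Ultrafiber U ≃⋆ₐ[ℂ]
        NonUnitalStarSubalgebra.center ℂ (E.Ultrafiber U),
      (∀ z : M.center,
        (φ (VonNeumannAlgebra.TracialCondExp.Ultrafiber.mk (E.restrictCenter hN) U z) :
            E.Ultrafiber U) =
          VonNeumannAlgebra.TracialCondExp.Ultrafiber.mk E U
            (VonNeumannAlgebra.inclusion M.center_le z)) ∧
      ∀ a : (E.restrictCenter hN).Ultrafiber U,
        VonNeumannAlgebra.TracialCondExp.Ultrafiber.trace E U (φ a : E.Ultrafiber U) =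
          VonNeumannAlgebra.TracialCondExp.Ultrafiber.trace (E.restrictCenter hN) U a) ∧
    (N = M.center → VonNeumannAlgebra.IsFactor (E.Ultrafiber U)) := by
  refine ⟨VonNeumannAlgebra.TracialCondExp.Ultrafiber.center_eq E U,
    ⟨VonNeumannAlgebra.TracialCondExp.Ultrafiber.centerEquiv E U hN, fun z => rfl, fun a => ?_⟩,
    fun h => ⟨VonNeumannAlgebra.TracialCondExp.Ultrafiber.nontrivial E U,
      ⟨E.GNS U, inferInstance, inferInstance, inferInstance, E.repClosure U,
        ⟨VonNeumannAlgebra.TracialCondExp.Ultrafiber.equivRepClosure E U hN⟩⟩,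
      VonNeumannAlgebra.TracialCondExp.Ultrafiber.center_eq_scalars E U h⟩⟩
  rw [VonNeumannAlgebra.TracialCondExp.Ultrafiber.coe_centerEquiv,
    VonNeumannAlgebra.TracialCondExp.Ultrafiber.trace_ofCenter]
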